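/- **Setting.** Let $X_1,\dots,X_n$ be i.i.d. uniform on $[0,1)$, let $\mathcal H^+\subseteq\{1,\dots,n\}$ with $m=|\mathcal H^+|$, let $\mathcal H^-$ be its complement, and let $a\in\mathbb R$. Let $b(i,j)$, $j\ge 1$, be the standard binary digits of $X_i$: $X(i,1)=X_i$, $b(i,j)=\lfloor 2X(i,j)\rfloor$, $X(i,j+1)=2X(i,j)-b(i,j)$. Put $$B(l)=\sum_{i\in\mathcal H^+}b(i,l)-\sum_{i\in\mathcal H^-}b(i,l),\quad Z(k)=\sum_{l=1}^kB(l)2^{-l},\quad L(k)=a-m2^{-k},\quad U(k)=a+(n-m)2^{-k}.$$ In round $k\ge1$ the leader signals $0$ if $Z(k)\le L(k)$, $1$ if $Z(k)\ge U(k)$, and "continue" otherwise. Let $T$ be the first round $k\ge 1$ whose signal is not "continue", and $\bar T=E[T]$. Fix real $\alpha,\beta$ with $a=\alpha n$ and $m=\beta n$, and put $\gamma=\alpha+\tfrac12-\beta$, $\sigma=\sqrt{n(1-4^{-k})/12}$, $$A(n,k,\gamma)=\tfrac12\left[\operatorname{erf}\!\left(\frac{(\gamma+2^{-(k+1)})n}{\sqrt2\,\sigma}\right)-\operatorname{erf}\!\left(\frac{(\gamma-2^{-(k+1)})n}{\sqrt2\,\sigma}\right)\right],$$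 where $\operatorname{erf}(x)=\frac{2}{\sqrt\pi}\int_0^xe^{-t^2}\,dt$, and $\varepsilon(n,k,\gamma)=P[L(k)<Z(k)<U(k)]-A(n,k,\gamma)$. **Theorem.** Let $\alpha,\beta$ be fixed and let $n\to\infty$ along any sequence of positive integers with $\beta n\in\{0,1,\dots,n\}$, where for each $n$ the set $\mathcal H^+$ is any set of size $m=\beta n$. Then the series $\sum_{k\ge1}A(n,k,\gamma)$ and $\sum_{k\ge1}\varepsilon(n,k,\gamma)$ converge absolutely for every such $n$, and $$\lim_{n\to\infty}\sum_{k=1}^\infty\varepsilon(n,k,\gamma)=0;\qquad\text{moreover}\qquad \sum_{k=1}^\infty|\varepsilon(n,k,\gamma)|\le(1+o(1))\,\frac{\log n}{\sqrt n}\quad(n\to\infty),$$ with $\log$ the natural logarithm. Consequently, for every such $n$, $$\bar T\le 1+\sum_{k=1}^\infty A(n,k,\gamma)+\sum_{k=1}^\infty\varepsilon(n,k,\gamma),$$ the limit $S=\lim_{n\to\infty}\sum_{k=1}^\infty A(n,k,\gamma)$ exists in $[0,\infty]$, and $$\limsup_{n\to\infty}\bar T\;\le\;\lim_{n\to\infty}\Bigl(1+\sum_{k=1}^\infty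 P[L(k)<Z(k)<U(k)]\Bigr)=1+S.$$ -/

import Mathlib

open Filter Topology MeasureTheory
open scoped ENNReal

noncomputable section

namespace BitExchange

/-- The dynamics of the binary expansion of an observation `x`: `X(1) = x` and
`X(j+1) = 2 X(j) - ⌊2 X(j)⌋` for `j ≥ 1`.  Time starts at `1`; the value at `0` is never used. -/
def residual (x : ℝ) : ℕ → ℝ
  | 0 => x
  | 1 => x
  | j + 2 => 2 * residual x (j + 1) - (⌊2 * residual x (j + 1)⌋ : ℝ)

/-- The bit `b(j) = ⌊2 X(j)⌋` sent in round `j ≥ 1` by the node that observes `x`. -/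
def bit (x : ℝ) (j : ℕ) : ℤ := ⌊2 * residual x j⌋

variable {n : ℕ}

/-- The law of the observations: `n` i.i.d. random variables, uniform on `[0, 1)`. -/
def obsLaw (n : ℕ) : Measure (Fin n → ℝ) :=
  Measure.pi fun _ => (volume : Measure ℝ).restrict (Set.Ico 0 1)

/-- `B(l)`, the signed number of ones in round `l`; `H` is the set of nodes with weight `+1` and its
complement the set of nodes with weight `-1`. -/
def signedCount (H : Finset (Fin n)) (x : Fin n → ℝ) (l : ℕ) : ℤ :=
  ∑ i ∈ H, bit (x i) l - ∑ i ∈ Hᶜ, bit (x i) l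

/-- `Z(j) = ∑_{l=1}^{j} B(l) 2^{-l}`. -/
def partialSum (H : Finset (Fin n)) (x : Fin n → ℝ) (j : ℕ) : ℝ :=
  ∑ l ∈ Finset.Icc 1 j, (signedCount H x l : ℝ) / 2 ^ l

/-- `L(j) = a - m 2^{-j}` with `m = |H|`. -/
def lowerThr (H : Finset (Fin n)) (a : ℝ) (j : ℕ) : ℝ :=
  a - (H.card : ℝ) / 2 ^ j

/-- `U(j) = a + (n - m) 2^{-j}` with `m = |H|`. -/
def upperThr (H : Finset (Fin n)) (a : ℝ) (j : ℕ) : ℝ :=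
  a + ((n : ℝ) - (H.card : ℝ)) / 2 ^ j

/-- The three values of the leader's feedback: class `0`, class `1`, or continue. -/
inductive Signal
  | zero
  | one
  | goOn

open Classical in
/-- The leader's feedback `s(j)` at the end of round `j`. -/
def feedback (H : Finset (Fin n)) (a : ℝ) (x : Fin n → ℝ) (j : ℕ) : Signal :=
  if partialSum H x j ≤ lowerThr H a j then Signal.zero
  else if upperThr H a j ≤ partialSum H x j then Signal.one
  else Signal.goOn

/-- The stopping time `T`: the smallest round `j ≥ 1` in which the feedback is not "continue"
(infinite if there is none). -/
def stopTime (H : Finset (Fin n)) (a : ℝ) (x : Fin n → ℝ) : ℕ∞ :=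
  sInf {t : ℕ∞ | ∃ j : ℕ, 1 ≤ j ∧ feedback H a x j ≠ Signal.goOn ∧ t = (j : ℕ∞)}

/-- The mean stopping time `E[T]`. -/
def meanStopTime (H : Finset (Fin n)) (a : ℝ) : ℝ≥0∞ :=
  ∫⁻ x, ((stopTime H a x : ℕ∞) : ℝ≥0∞) ∂(obsLaw n)

/-- The probability `P[L(k) < Z(k) < U(k)]`. -/
def bandProb (H : Finset (Fin n)) (a : ℝ) (k : ℕ) : ℝ≥0∞ :=
  obsLaw n {x | lowerThr H a k < partialSum H x k ∧ partialSum H x k < upperThr H a k}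

/-- The error function `erf x = (2/√π) ∫_0^x exp(-t²) dt`. -/
def erf (x : ℝ) : ℝ := 2 / √Real.pi * ∫ t in (0 : ℝ)..x, Real.exp (-t ^ 2)

/-- `σ = √(n (1 - 4^{-k}) / 12)`. -/
def stdDev (n k : ℕ) : ℝ := √((n : ℝ) * (1 - 1 / 4 ^ k) / 12)

/-- The Gaussian approximation `A(n, k, γ)`. -/
def gaussApprox (n k : ℕ) (γ : ℝ) : ℝ :=
  1 / 2 * (erf ((γ + 1 / 2 ^ (k + 1)) * n / (√2 * stdDev n k))
    - erf ((γ - 1 / 2 ^ (k + 1)) * n / (√2 * stdDev n k)))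

/-- The error `P[L(k) < Z(k) < U(k)] - A(n, k, γ)` of the Gaussian approximation, for the threshold
`a = α n` and `m = |H| = β n`, where `γ = α + (1/2 - β)`. -/
def cltError (H : Finset (Fin n)) (α β : ℝ) (k : ℕ) : ℝ :=
  (bandProb H (α * n) k).toReal - gaussApprox n k (α + (1 / 2 - β))

end BitExchange

end

/-! In lattice units, 2^k Z(k) is a sum of n independent terms ±⌊2^k X_i⌋, each uniform up to sign
on 2^k consecutive integers. Up to a phase, every term has characteristic function `cosProd k`, so
the sum has `cosProd k ^ n` whatever the set H is. Fourier inversion on [-π, π] gives a local limit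
theorem uniform in k: each point mass differs from the normal mass of its unit cell by O(2^{-k}
n^{-3/2}) (`exists_abs_pointMass_sub_le`). The exponent is 3/2 rather than 1 because the centred law
is symmetric, so the first correction is of fourth order in the frequency. The band holds at most n
lattice points, and its two ends miss the cell boundaries by at most half a cell. Round k therefore
costs O(2^{-k} n^{-1/2}) (`exists_abs_cltError_le`), and a geometric sum over k leaves O(n^{-1/2}),
eventually below log n / √n. Summability for every n, including n = 1, comes from the cruder
estimates `toReal_bandProb_le` and `gaussApprox_le`. The limit S depends on γ. If γ ≠ 0, the
Gaussian terms have a summable majorant independent of n (`gaussApprox_le_of_ne_zero`), so limit and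
sum commute. If γ = 0, every term tends to 1 and S = ∞. Finally, T is at most 1 plus the number of
"continue" rounds; integrating this bounds the mean. -/

namespace BitExchange

open Real

/-! ### Pointwise bounds on the characteristic function -/

/-- The characteristic function `∏_{l<k} cos (2^l t / 2)` of the centred uniform distribution on
`2^k` consecutive integers. -/
noncomputable def cosProd (k : ℕ) (t : ℝ) : ℝ := ∏ l ∈ Finset.range k, cos (2 ^ l * t / 2)

lemma cosProd_succ (k : ℕ) (t : ℝ) : cosProd (k + 1) t = cosProd k t * cos (2 ^ k * t / 2) :=
  Finset.prod_range_succ _ _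

lemma continuous_cosProd (k : ℕ) : Continuous (cosProd k) := by
  unfold cosProd
  fun_prop

lemma cosProd_neg (k : ℕ) (t : ℝ) : cosProd k (-t) = cosProd k t := by
  unfold cosProd
  refine Finset.prod_congr rfl fun l _ => ?_
  rw [← cos_neg]
  congr 1
  ring

lemma abs_cosProd_le_one (k : ℕ) (t : ℝ) : |cosProd k t| ≤ 1 := by
  unfold cosProd
  rw [Finset.abs_prod]
  exact Finset.prod_le_one (fun _ _ => abs_nonneg _) fun _ _ => abs_cos_le_one _

/-- Viète's telescoping: each factor is absorbed by sin 2y = 2 sin y cos y. Away from 0 this is the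
source of the decay of `cosProd`. -/
lemma sin_mul_cosProd (k : ℕ) (t : ℝ) :
    2 ^ k * sin (t / 2) * cosProd k t = sin (2 ^ k * t / 2) := by
  induction k with
  | zero => simp [cosProd]
  | succ k ih =>
    have h : (2 : ℝ) ^ (k + 1) * t / 2 = 2 * (2 ^ k * t / 2) := by ring
    rw [cosProd_succ, h, sin_two_mul, ← ih]
    ring

lemma abs_cosProd_le_div (k : ℕ) {t : ℝ} (h0 : t ≠ 0) (ht : |t| ≤ π) :
    |cosProd k t| ≤ π / (2 ^ k * |t|) := by
  have h1 := mul_abs_le_abs_sin (x := t / 2) (by rw [abs_div, abs_two]; linarith)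
  have h2 : 2 ^ k * |sin (t / 2)| * |cosProd k t| ≤ 1 := by
    have h := congrArg abs (sin_mul_cosProd k t)
    rw [abs_mul, abs_mul, abs_pow, abs_two] at h
    rw [h]
    exact abs_sin_le_one _
  have h3 : 0 < |t| := abs_pos.mpr h0
  have h4 : 2 / π * |t / 2| = |t| / π := by rw [abs_div, abs_two]; field_simp
  rw [h4] at h1
  rw [le_div_iff₀ (by positivity)]
  have h5 : 2 ^ k * (|t| / π) * |cosProd k t| ≤ 1 := le_trans (by gcongr) h2
  calc |cosProd k t| * (2 ^ k * |t|) = π * (2 ^ k * (|t| / π) * |cosProd k t|) := by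
        field_simp
    _ ≤ π * 1 := by gcongr
    _ = π := mul_one _

/-- The highest-frequency factor alone, cos(2^k t / 4), already decays on the scale 2^{-k}; the
others are bounded by 1. -/
lemma abs_cosProd_le_exp {k : ℕ} (hk : 1 ≤ k) {t : ℝ} (ht : |2 ^ k * t| ≤ 2 * π) :
    |cosProd k t| ≤ exp (-((2 ^ k * t) ^ 2 / (8 * π ^ 2))) := by
  obtain ⟨k, rfl⟩ : ∃ j, k = j + 1 := ⟨k - 1, by omega⟩
  have e : (2 : ℝ) ^ k * t / 2 = 2 ^ (k + 1) * t / 4 := by ring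
  have h1 : |2 ^ (k + 1) * t / 4| ≤ π / 2 := by
    rw [abs_div, abs_of_pos (by norm_num : (0 : ℝ) < 4)]
    linarith
  rw [cosProd_succ, abs_mul, e]
  generalize 2 ^ (k + 1) * t = u at *
  have h2 : 0 ≤ cos (u / 4) := cos_nonneg_of_mem_Icc (abs_le.mp h1)
  calc |cosProd k t| * |cos (u / 4)| ≤ 1 * cos (u / 4) := by
        rw [abs_of_nonneg h2]
        gcongr
        exact abs_cosProd_le_one k t
    _ ≤ 1 - 2 / π ^ 2 * (u / 4) ^ 2 := by
        rw [one_mul]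
        exact cos_le_one_sub_mul_cos_sq (by linarith [pi_pos])
    _ ≤ exp (-(u ^ 2 / (8 * π ^ 2))) := by
        have := add_one_le_exp (-(u ^ 2 / (8 * π ^ 2)))
        refine le_trans (le_of_eq ?_) this
        field_simp
        ring

lemma abs_cos_sub_exp_le (x : ℝ) : |cos x - exp (-(x ^ 2 / 2))| ≤ 2 * x ^ 4 := by
  have hexp : |exp (-(x ^ 2 / 2)) - (1 - x ^ 2 / 2)| ≤ x ^ 4 := by
    have h1 := add_one_le_exp (-(x ^ 2 / 2))
    have h2 := add_one_le_exp (x ^ 2 / 2)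
    have h3 : exp (-(x ^ 2 / 2)) ≤ 1 / (1 + x ^ 2 / 2) := by
      rw [exp_neg, ← one_div]
      exact one_div_le_one_div_of_le (by positivity) (by linarith)
    have h4 : 1 / (1 + x ^ 2 / 2) ≤ 1 - x ^ 2 / 2 + x ^ 4 := by
      rw [div_le_iff₀ (by positivity)]
      nlinarith [sq_nonneg (x ^ 2), sq_nonneg (x ^ 3), sq_nonneg x]
    rw [abs_le]
    constructor <;> nlinarith [sq_nonneg (x ^ 2)]
  rcases le_total |x| 1 with h | h
  · have h1 := cos_bound h
    have h2 : |x| ^ 4 = x ^ 4 := by rw [← abs_pow]; exact abs_of_nonneg (by positivity)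
    rw [h2] at h1
    have h3 : 0 ≤ x ^ 4 := by positivity
    rw [abs_le] at *
    constructor <;> linarith [hexp.1, hexp.2, h1.1, h1.2]
  · have h1 : (1 : ℝ) ≤ x ^ 4 := by
      have : (1 : ℝ) ≤ |x| ^ 4 := one_le_pow₀ h
      rwa [← abs_pow, abs_of_nonneg (by positivity)] at this
    have h2 : exp (-(x ^ 2 / 2)) ≤ 1 := exp_le_one_iff.mpr (by nlinarith [sq_nonneg x])
    rw [abs_le]
    constructor <;> linarith [neg_one_le_cos x, cos_le_one x, exp_pos (-(x ^ 2 / 2))]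

/-- Factors are replaced by Gaussians one at a time; the exponents (2^l t / 2)² / 2 add up to (4^k -
1) t² / 24. A new factor adds an error (2^k t)^4 / 8, while the allowed bound grows by a factor 16.
-/
lemma abs_cosProd_sub_exp_le (k : ℕ) (t : ℝ) :
    |cosProd k t - exp (-((4 ^ k - 1) / 24 * t ^ 2))| ≤ (2 ^ k * t) ^ 4 := by
  induction k with
  | zero => simp [cosProd]; positivity
  | succ k ih =>
    have e : exp (-((4 ^ (k + 1) - 1) / 24 * t ^ 2))
        = exp (-((4 ^ k - 1) / 24 * t ^ 2)) * exp (-((2 ^ k * t / 2) ^ 2 / 2)) := by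
      rw [← exp_add]
      congr 1
      have : (4 : ℝ) ^ k = (2 ^ k) ^ 2 := by rw [← pow_mul, mul_comm, pow_mul]; norm_num
      rw [pow_succ, this]
      ring
    rw [cosProd_succ, e]
    set f := cosProd k t
    set g := exp (-((4 ^ k - 1) / 24 * t ^ 2))
    set c := cos (2 ^ k * t / 2)
    set d := exp (-((2 ^ k * t / 2) ^ 2 / 2))
    have hd : |c - d| ≤ 2 * (2 ^ k * t / 2) ^ 4 := abs_cos_sub_exp_le _
    have hf : |f| ≤ 1 := abs_cosProd_le_one k t
    have hd1 : |d| ≤ 1 := by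
      rw [abs_of_pos (exp_pos _)]
      exact exp_le_one_iff.mpr (by simp; positivity)
    calc |f * c - g * d| = |f * (c - d) + (f - g) * d| := by ring_nf
      _ ≤ |f * (c - d)| + |(f - g) * d| := abs_add_le _ _
      _ = |f| * |c - d| + |f - g| * |d| := by rw [abs_mul, abs_mul]
      _ ≤ 1 * (2 * (2 ^ k * t / 2) ^ 4) + (2 ^ k * t) ^ 4 * 1 := by gcongr
      _ ≤ (2 ^ (k + 1) * t) ^ 4 := by
        have : 0 ≤ (2 ^ k * t) ^ 4 := by positivity
        have e1 : (2 ^ (k + 1) * t) ^ 4 = 16 * (2 ^ k * t) ^ 4 := by ring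
        have e2 : (2 ^ k * t / 2) ^ 4 = (2 ^ k * t) ^ 4 / 16 := by ring
        rw [e1, e2]
        linarith

/-- Puts the Gaussian under the same majorant as `cosProd`, so that one bound controls the maximum
in the estimate of a difference of n-th powers. -/
lemma exp_variance_le {k : ℕ} (hk : 1 ≤ k) (t : ℝ) :
    exp (-((4 ^ k - 1) / 24 * t ^ 2)) ≤ exp (-((2 ^ k * t) ^ 2 / (8 * π ^ 2))) := by
  rw [exp_le_exp, neg_le_neg_iff]
  have h4 : (4 : ℝ) ^ k = (2 ^ k) ^ 2 := by rw [← pow_mul, mul_comm, pow_mul]; norm_num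
  have h1 : (4 : ℝ) ≤ 4 ^ k := le_self_pow₀ (by norm_num) (by omega)
  have h3 : (8 : ℝ) * 4 ≤ 8 * π ^ 2 := by nlinarith [pi_gt_three]
  calc (2 ^ k * t) ^ 2 / (8 * π ^ 2) ≤ (2 ^ k * t) ^ 2 / (8 * 4) := by gcongr
    _ = 4 ^ k / 32 * t ^ 2 := by rw [h4]; ring
    _ ≤ (4 ^ k - 1) / 24 * t ^ 2 := by gcongr ?_ * t ^ 2; linarith

/-- Pointwise comparison of the characteristic functions of the sum and of its Gaussian
approximation. -/
lemma abs_indicator_cosProd_pow_sub_exp_le {k n : ℕ} (hk : 1 ≤ k) (hn : 2 ≤ n) (t : ℝ) :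
    |(Set.Icc (-π) π).indicator (fun t => cosProd k t ^ n) t
        - exp (-((4 ^ k - 1) / 24 * t ^ 2)) ^ n|
      ≤ n * ((2 ^ k * t) ^ 4 * exp (-(n * (2 ^ k * t) ^ 2 / (16 * π ^ 2))))
        + (1 / 2) ^ (n - 2) * (20 * (1 + (2 ^ k * t) ^ 2)⁻¹) := by
  have hk2 : (2 : ℝ) ≤ 2 ^ k := le_self_pow₀ (by norm_num) (by omega)
  have hπ := pi_pos
  have hn2 : (2 : ℝ) ≤ n := by exact_mod_cast hn
  set u := 2 ^ k * t with hu
  set g := exp (-((4 ^ k - 1) / 24 * t ^ 2)) with hg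
  set r := exp (-(u ^ 2 / (8 * π ^ 2))) with hr
  have hgr : g ≤ r := exp_variance_le hk t
  have hg0 : 0 < g := exp_pos _
  -- Uses n - 1 ≥ n / 2, which is why 8 π² becomes 16 π².
  have hrn : r ^ (n - 1) ≤ exp (-(n * u ^ 2 / (16 * π ^ 2))) := by
    rw [hr, ← exp_nat_mul, exp_le_exp, Nat.cast_sub (by omega), Nat.cast_one]
    have h1 : 0 ≤ u ^ 2 / (16 * π ^ 2) := by positivity
    have e1 : u ^ 2 / (8 * π ^ 2) = 2 * (u ^ 2 / (16 * π ^ 2)) := by field_simp; ring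
    have e2 : n * u ^ 2 / (16 * π ^ 2) = n * (u ^ 2 / (16 * π ^ 2)) := by ring
    rw [e1, e2]
    nlinarith
  have hgn : g ^ n ≤ exp (-(n * u ^ 2 / (16 * π ^ 2))) := by
    have h1 : g ≤ 1 := hgr.trans (exp_le_one_iff.mpr (by simp; positivity))
    calc g ^ n ≤ g ^ (n - 1) := pow_le_pow_of_le_one hg0.le h1 (by omega)
      _ ≤ r ^ (n - 1) := by gcongr
      _ ≤ _ := hrn
  have htail : 0 ≤ (1 / 2 : ℝ) ^ (n - 2) * (20 * (1 + u ^ 2)⁻¹) := by positivity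
  have habs : |u| = 2 ^ k * |t| := by rw [hu, abs_mul, abs_pow, abs_two]
  -- For |u| ≤ 2π the n-th powers are compared directly. Beyond it the Gaussian is absorbed by the
  -- first term, as u^4 ≥ 1, and |`cosProd`| ≤ π / |u| ≤ 1/2: two of its n powers are kept for
  -- integrability and the other n - 2 give the small factor.
  rcases le_or_gt |u| (2 * π) with h | h
  · have htπ : |t| ≤ π := by nlinarith [abs_nonneg t]
    rw [Set.indicator_of_mem (show t ∈ Set.Icc (-π) π from abs_le.mp htπ)]
    have h1 : |cosProd k t ^ n - g ^ n| ≤ n * (u ^ 4 * exp (-(n * u ^ 2 / (16 * π ^ 2)))) := by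
      have hf : |cosProd k t| ≤ r := abs_cosProd_le_exp hk h
      calc |cosProd k t ^ n - g ^ n|
          ≤ |cosProd k t - g| * n * max |cosProd k t| |g| ^ (n - 1) := abs_pow_sub_pow_le _ _ _
        _ ≤ u ^ 4 * n * r ^ (n - 1) := by
          gcongr
          · exact abs_cosProd_sub_exp_le k t
          · exact max_le hf (by rwa [abs_of_pos hg0])
        _ ≤ u ^ 4 * n * exp (-(n * u ^ 2 / (16 * π ^ 2))) := by gcongr
        _ = _ := by ring
    linarith
  · have hu1 : 1 ≤ |u| := by linarith [pi_gt_three]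
    have hu4 : 1 ≤ u ^ 4 := by
      have : (1 : ℝ) ≤ |u| ^ 4 := one_le_pow₀ hu1
      rwa [← abs_pow, abs_of_nonneg (by positivity)] at this
    have hu2 : 1 ≤ u ^ 2 := by
      have : (1 : ℝ) ≤ |u| ^ 2 := one_le_pow₀ hu1
      rwa [sq_abs] at this
    have hg2 : g ^ n ≤ n * (u ^ 4 * exp (-(n * u ^ 2 / (16 * π ^ 2)))) := by
      refine hgn.trans ?_
      have h0 := exp_pos (-(n * u ^ 2 / (16 * π ^ 2)))
      have h1 : exp (-(n * u ^ 2 / (16 * π ^ 2))) ≤ u ^ 4 * exp (-(n * u ^ 2 / (16 * π ^ 2))) :=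
        le_mul_of_one_le_left h0.le hu4
      refine h1.trans (le_mul_of_one_le_left (by positivity) (by linarith))
    by_cases ht : t ∈ Set.Icc (-π) π
    · rw [Set.indicator_of_mem ht]
      have h0 : t ≠ 0 := by
        rintro rfl
        simp [hu] at hu1
        linarith
      have hf := abs_cosProd_le_div k h0 (abs_le.mpr ht)
      rw [← habs] at hf
      have hhalf : π / |u| ≤ 1 / 2 := by
        rw [div_le_div_iff₀ (by linarith) (by norm_num)]
        linarith
      have hsq : (π / |u|) ^ 2 ≤ 20 * (1 + u ^ 2)⁻¹ := by
        rw [div_pow, sq_abs, ← div_eq_mul_inv, div_le_div_iff₀ (by positivity) (by positivity)]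
        have : π ^ 2 ≤ 10 := by nlinarith [pi_lt_d2]
        nlinarith
      have hfn : |cosProd k t ^ n| ≤ (1 / 2) ^ (n - 2) * (20 * (1 + u ^ 2)⁻¹) := by
        rw [abs_pow]
        calc |cosProd k t| ^ n ≤ (π / |u|) ^ n := by gcongr
          _ = (π / |u|) ^ (n - 2) * (π / |u|) ^ 2 := by rw [← pow_add]; congr 1; omega
          _ ≤ _ := by gcongr
      calc |cosProd k t ^ n - g ^ n| ≤ |cosProd k t ^ n| + |g ^ n| := abs_sub _ _
        _ = |cosProd k t ^ n| + g ^ n := by rw [abs_of_pos (by positivity : 0 < g ^ n)]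
        _ ≤ _ := by linarith
    · rw [Set.indicator_of_notMem ht, zero_sub, abs_neg, abs_of_pos (by positivity)]
      linarith

/-! ### Integrated comparison with the Gaussian -/

lemma integrable_pow_mul_exp_neg_mul_sq {b : ℝ} (hb : 0 < b) (m : ℕ) :
    Integrable fun y : ℝ => y ^ m * exp (-(b * y ^ 2)) := by
  have h := integrable_rpow_mul_exp_neg_mul_sq hb (s := m) (by linarith [m.cast_nonneg (α := ℝ)])
  simpa only [rpow_natCast, neg_mul] using h

lemma sq_le_two_mul_two_pow (n : ℕ) : n ^ 2 ≤ 2 * 2 ^ n := by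
  induction n with
  | zero => simp
  | succ n ih =>
    rcases lt_or_ge n 3 with h | h
    · interval_cases n <;> norm_num
    · rw [pow_succ 2 n]
      nlinarith

lemma half_pow_le {n : ℕ} (hn : 2 ≤ n) : (1 / 2 : ℝ) ^ (n - 2) ≤ 8 / (n * √n) := by
  have h1 : (1 : ℝ) ≤ n := by exact_mod_cast (by omega : 1 ≤ n)
  have h2 : √(n : ℝ) ≤ n := by
    rw [sqrt_le_left (by linarith)]
    nlinarith
  have h3 : (n : ℝ) ^ 2 ≤ 2 * 2 ^ n := by exact_mod_cast sq_le_two_mul_two_pow n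
  have h4 : (2 : ℝ) ^ n = 2 ^ (n - 2) * 4 := by
    conv_lhs => rw [show n = n - 2 + 2 by omega, pow_add]
    norm_num
  have h5 : 0 < √(n : ℝ) := sqrt_pos.mpr (by linarith)
  rw [one_div, inv_pow, ← one_div, div_le_div_iff₀ (by positivity) (by positivity)]
  nlinarith

lemma exists_abs_integral_cosProd_pow_sub_le :
    ∃ C : ℝ, 0 < C ∧ ∀ k n : ℕ, 1 ≤ k → 2 ≤ n → ∀ x : ℝ,
      |(∫ t in (-π)..π, cosProd k t ^ n * cos (t * x))
        - ∫ t : ℝ, exp (-((4 ^ k - 1) / 24 * t ^ 2)) ^ n * cos (t * x)|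
        ≤ C / (2 ^ k * (n * √n)) := by
  have hb : 0 < 1 / (16 * π ^ 2) := by positivity
  set h : ℝ → ℝ := fun y => y ^ 4 * exp (-(1 / (16 * π ^ 2) * y ^ 2)) with hh
  have hint : Integrable h := integrable_pow_mul_exp_neg_mul_sq hb 4
  set K := ∫ y, h y with hK
  have hK0 : 0 ≤ K := integral_nonneg fun y => by simp only [hh]; positivity
  -- K comes from the central term. In 160 π = 8 · 20 · π, the 8 is from `half_pow_le`, the 20 from
  -- the tail majorant, and π is the integral of 1 / (1 + y²).
  refine ⟨K + 160 * π, by positivity, fun k n hk hn x => ?_⟩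
  have hn0 : (0 : ℝ) < n := by exact_mod_cast (by omega : 0 < n)
  have hs : 0 < √(n : ℝ) := sqrt_pos.mpr hn0
  have hss : √(n : ℝ) ^ 2 = n := sq_sqrt hn0.le
  have h2k : (0 : ℝ) < 2 ^ k := by positivity
  have h4 : (0 : ℝ) < (4 ^ k - 1) / 24 := by
    have : (4 : ℝ) ≤ 4 ^ k := le_self_pow₀ (by norm_num) (by omega)
    linarith
  set F : ℝ → ℝ := (Set.Icc (-π) π).indicator (fun t => cosProd k t ^ n) with hF
  set G : ℝ → ℝ := fun t => exp (-((4 ^ k - 1) / 24 * t ^ 2)) ^ n with hG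
  have hFint : Integrable F := by
    rw [hF, integrable_indicator_iff measurableSet_Icc]
    exact ((continuous_cosProd k).pow n).continuousOn.integrableOn_compact isCompact_Icc
  have hGint : Integrable G := by
    have := integrable_pow_mul_exp_neg_mul_sq (b := n * ((4 ^ k - 1) / 24)) (by positivity) 0
    refine this.congr (Eventually.of_forall fun t => ?_)
    simp only [hG, pow_zero, one_mul, ← exp_nat_mul]
    congr 1
    ring
  have hbd : ∀ {f : ℝ → ℝ}, Integrable f → Integrable fun t => f t * cos (t * x) := fun hf =>
    hf.mul_bdd (c := 1) (by fun_prop) (Eventually.of_forall fun t => abs_cos_le_one _)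
  have e1 : (∫ t in (-π)..π, cosProd k t ^ n * cos (t * x)) = ∫ t, F t * cos (t * x) := by
    rw [intervalIntegral.integral_of_le (by linarith [pi_pos]), ← integral_Icc_eq_integral_Ioc,
      ← integral_indicator measurableSet_Icc]
    congr 1
    ext t
    by_cases ht : t ∈ Set.Icc (-π) π <;> simp [hF, ht]
  set B1 : ℝ → ℝ := fun t =>
    n * ((2 ^ k * t) ^ 4 * exp (-(n * (2 ^ k * t) ^ 2 / (16 * π ^ 2)))) with hB1
  set B2 : ℝ → ℝ := fun t => (1 / 2) ^ (n - 2) * (20 * (1 + (2 ^ k * t) ^ 2)⁻¹) with hB2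
  -- In the variable y = 2^k √n t the factor n (2^k t)^4 becomes y^4 / n; the Jacobian supplies the
  -- remaining 1 / (2^k √n).
  have eB1 : B1 = fun t => (n : ℝ)⁻¹ * h (2 ^ k * √n * t) := by
    ext t
    simp only [hB1, hh]
    have e2 : 1 / (16 * π ^ 2) * (2 ^ k * √n * t) ^ 2 = n * (2 ^ k * t) ^ 2 / (16 * π ^ 2) := by
      rw [mul_pow, mul_pow, hss]
      ring
    have e3 : (2 ^ k * √n * t) ^ 4 = n ^ 2 * (2 ^ k * t) ^ 4 := by
      calc (2 ^ k * √n * t) ^ 4 = (√(n : ℝ) ^ 2) ^ 2 * (2 ^ k * t) ^ 4 := by ring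
        _ = _ := by rw [hss]
    rw [e2, e3]
    field_simp
  have iB1 : Integrable B1 := by
    rw [eB1]
    exact (hint.comp_mul_left' (by positivity)).const_mul _
  have iB2 : Integrable B2 :=
    ((integrable_inv_one_add_sq.comp_mul_left' h2k.ne').const_mul 20).const_mul _
  have vB1 : ∫ t, B1 t = K / (2 ^ k * (n * √n)) := by
    rw [eB1, integral_const_mul, Measure.integral_comp_mul_left h (2 ^ k * √n),
      abs_of_pos (by positivity), ← hK, smul_eq_mul]
    field_simp
  have vB2 : ∫ t, B2 t ≤ 160 * π / (2 ^ k * (n * √n)) := by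
    simp only [hB2]
    rw [integral_const_mul, integral_const_mul,
      Measure.integral_comp_mul_left (fun y : ℝ => (1 + y ^ 2)⁻¹) (2 ^ k),
      integral_univ_inv_one_add_sq, abs_of_pos (by positivity), smul_eq_mul]
    calc (1 / 2 : ℝ) ^ (n - 2) * (20 * ((2 ^ k)⁻¹ * π))
        ≤ 8 / (n * √n) * (20 * ((2 ^ k)⁻¹ * π)) := by gcongr; exact half_pow_le hn
      _ = 160 * π / (2 ^ k * (n * √n)) := by field_simp; norm_num
  rw [e1, ← integral_sub (hbd hFint) (hbd hGint)]
  calc |∫ t, (F t * cos (t * x) - G t * cos (t * x))| ≤ ∫ t, (B1 t + B2 t) := by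
        rw [← norm_eq_abs]
        refine norm_integral_le_of_norm_le (iB1.add iB2) (Eventually.of_forall fun t => ?_)
        rw [← sub_mul, norm_mul, norm_eq_abs, norm_eq_abs]
        calc |F t - G t| * |cos (t * x)| ≤ |F t - G t| * 1 := by
              gcongr
              exact abs_cos_le_one _
          _ ≤ B1 t + B2 t := by
              rw [mul_one]
              exact abs_indicator_cosProd_pow_sub_exp_le hk hn t
    _ = (∫ t, B1 t) + ∫ t, B2 t := integral_add iB1 iB2
    _ ≤ K / (2 ^ k * (n * √n)) + 160 * π / (2 ^ k * (n * √n)) := by rw [vB1]; gcongr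
    _ = _ := by ring

/-! ### The normal density and the midpoint rule -/

/-- The density of the centred normal law with standard deviation `τ`. -/
noncomputable def normalDensity (τ x : ℝ) : ℝ := exp (-(x ^ 2 / (2 * τ ^ 2))) / (τ * √(2 * π))

lemma continuous_normalDensity (τ : ℝ) : Continuous (normalDensity τ) := by
  unfold normalDensity
  fun_prop

lemma normalDensity_nonneg {τ : ℝ} (hτ : 0 < τ) (x : ℝ) : 0 ≤ normalDensity τ x := by
  unfold normalDensity
  positivity

lemma normalDensity_le {τ : ℝ} (hτ : 0 < τ) (x : ℝ) : normalDensity τ x ≤ 1 / τ := by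
  have h1 : 1 ≤ √(2 * π) := one_le_sqrt.mpr (by linarith [pi_gt_three])
  have h2 : exp (-(x ^ 2 / (2 * τ ^ 2))) ≤ 1 := exp_le_one_iff.mpr (by simp; positivity)
  unfold normalDensity
  gcongr
  exact le_mul_of_one_le_right hτ.le h1

lemma integral_exp_mul_cos {τ : ℝ} (hτ : 0 < τ) (x : ℝ) :
    ∫ t : ℝ, exp (-(τ ^ 2 / 2 * t ^ 2)) * cos (t * x) = 2 * π * normalDensity τ x := by
  have hb : 0 < (((τ ^ 2 / 2 : ℝ)) : ℂ).re := by rw [Complex.ofReal_re]; positivity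
  have h := congrArg Complex.re (fourierIntegral_gaussian hb (x : ℂ))
  have hi : Integrable fun t : ℝ =>
      Complex.exp (Complex.I * x * t) * Complex.exp (-((τ ^ 2 / 2 : ℝ) : ℂ) * t ^ 2) := by
    have := integrable_cexp_quadratic' (b := -((τ ^ 2 / 2 : ℝ) : ℂ)) (by simpa using hb)
      (Complex.I * x) 0
    refine this.congr (Eventually.of_forall fun t => ?_)
    simp only [← Complex.exp_add]
    congr 1
    ring
  have hre : ∀ t : ℝ, (Complex.exp (Complex.I * x * t)
      * Complex.exp (-((τ ^ 2 / 2 : ℝ) : ℂ) * t ^ 2)).re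
      = exp (-(τ ^ 2 / 2 * t ^ 2)) * cos (t * x) := by
    intro t
    have e : Complex.exp (-((τ ^ 2 / 2 : ℝ) : ℂ) * t ^ 2)
        = ((exp (-(τ ^ 2 / 2 * t ^ 2)) : ℝ) : ℂ) := by push_cast; ring_nf
    have e2 : Complex.I * x * t = ((t * x : ℝ) : ℂ) * Complex.I := by push_cast; ring
    rw [e, e2, Complex.re_mul_ofReal, Complex.exp_ofReal_mul_I_re, mul_comm]
  have hI := integral_re hi
  simp only [RCLike.re_eq_complex_re, hre] at hI
  rw [hI, h]
  have e3 : ((π : ℂ) / ((τ ^ 2 / 2 : ℝ) : ℂ)) ^ (1 / 2 : ℂ) = ((√(π / (τ ^ 2 / 2)) : ℝ) : ℂ) := by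
    rw [sqrt_eq_rpow, Complex.ofReal_cpow (by positivity)]
    push_cast
    rfl
  have e4 : Complex.exp (-(x : ℂ) ^ 2 / (4 * ((τ ^ 2 / 2 : ℝ) : ℂ)))
      = ((exp (-(x ^ 2 / (2 * τ ^ 2))) : ℝ) : ℂ) := by
    push_cast
    congr 1
    field_simp
    norm_num
  rw [e3, e4, ← Complex.ofReal_mul, Complex.ofReal_re, normalDensity]
  have e5 : √(π / (τ ^ 2 / 2)) = √(2 * π) / τ := by
    rw [show π / (τ ^ 2 / 2) = 2 * π / τ ^ 2 by field_simp, sqrt_div' _ (by positivity),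
      sqrt_sq hτ.le]
  have e6 : √(2 * π) ^ 2 = 2 * π := sq_sqrt (by positivity)
  rw [e5]
  field_simp
  rw [e6]

/-- On the Fourier side a second difference multiplies the transform by 2 (cos(tv) - 1), which is at
most t² in absolute value for |v| ≤ 1. Rescaling t² exp(-τ² t² / 2) gives τ^{-3}. -/
lemma exists_abs_second_difference_normalDensity_le :
    ∃ C : ℝ, 0 < C ∧ ∀ τ : ℝ, 0 < τ → ∀ x v : ℝ, |v| ≤ 1 →
      |normalDensity τ (x + v) + normalDensity τ (x - v) - 2 * normalDensity τ x|
        ≤ C / τ ^ 3 := by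
  set h : ℝ → ℝ := fun y => y ^ 2 * exp (-(1 / 2 * y ^ 2)) with hh
  have hint : Integrable h := integrable_pow_mul_exp_neg_mul_sq (by norm_num) 2
  set K := ∫ y, h y with hK
  have hK0 : 0 ≤ K := integral_nonneg fun y => by simp only [hh]; positivity
  refine ⟨K + 1, by positivity, fun τ hτ x v hv => ?_⟩
  set E : ℝ → ℝ := fun t => exp (-(τ ^ 2 / 2 * t ^ 2)) with hE
  have hEi : Integrable E := by
    have := integrable_pow_mul_exp_neg_mul_sq (b := τ ^ 2 / 2) (by positivity) 0
    simpa using this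
  have hbd : ∀ y : ℝ, Integrable fun t => E t * cos (t * y) := fun y =>
    hEi.mul_bdd (c := 1) (by fun_prop) (Eventually.of_forall fun t => abs_cos_le_one _)
  have key : 2 * π * (normalDensity τ (x + v) + normalDensity τ (x - v) - 2 * normalDensity τ x)
      = ∫ t, (E t * cos (t * (x + v)) + E t * cos (t * (x - v)) - 2 * (E t * cos (t * x))) := by
    have hadd : Integrable fun t => E t * cos (t * (x + v)) + E t * cos (t * (x - v)) :=
      (hbd _).add (hbd _)
    rw [integral_sub hadd ((hbd _).const_mul 2), integral_add (hbd _) (hbd _),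
      integral_const_mul, integral_exp_mul_cos hτ, integral_exp_mul_cos hτ,
      integral_exp_mul_cos hτ]
    ring
  have hEh : ∀ t, t ^ 2 * E t = (τ ^ 2)⁻¹ * h (τ * t) := by
    intro t
    simp only [hE, hh]
    rw [show 1 / 2 * (τ * t) ^ 2 = τ ^ 2 / 2 * t ^ 2 by ring]
    field_simp
  have hbound : |∫ t, (E t * cos (t * (x + v)) + E t * cos (t * (x - v))
      - 2 * (E t * cos (t * x)))| ≤ K / τ ^ 3 := by
    have hi : Integrable fun t => (τ ^ 2)⁻¹ * h (τ * t) :=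
      (hint.comp_mul_left' hτ.ne').const_mul _
    have hv' : ∫ t, (τ ^ 2)⁻¹ * h (τ * t) = K / τ ^ 3 := by
      rw [integral_const_mul, Measure.integral_comp_mul_left h τ, abs_of_pos (by positivity),
        ← hK, smul_eq_mul]
      field_simp
    rw [← hv', ← norm_eq_abs]
    refine norm_integral_le_of_norm_le hi (Eventually.of_forall fun t => ?_)
    rw [← hEh, norm_eq_abs]
    have e : E t * cos (t * (x + v)) + E t * cos (t * (x - v)) - 2 * (E t * cos (t * x))
        = E t * (2 * cos (t * x) * (cos (t * v) - 1)) := by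
      rw [mul_add t, mul_sub t, cos_add, cos_sub]
      ring
    have hE0 : 0 ≤ E t := (exp_pos _).le
    have hc : |cos (t * v) - 1| ≤ t ^ 2 / 2 := by
      have h1 := one_sub_sq_div_two_le_cos (x := t * v)
      have h2 := cos_le_one (t * v)
      have h3 : (t * v) ^ 2 ≤ t ^ 2 := by
        rw [mul_pow]
        exact mul_le_of_le_one_right (sq_nonneg _) ((sq_le_one_iff_abs_le_one v).mpr hv)
      rw [abs_le]
      constructor <;> linarith [sq_nonneg t]
    rw [e, abs_mul, abs_of_nonneg hE0, abs_mul, abs_mul, abs_two]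
    calc E t * (2 * |cos (t * x)| * |cos (t * v) - 1|) ≤ E t * (2 * 1 * (t ^ 2 / 2)) := by
          gcongr
          exact abs_cos_le_one _
      _ = t ^ 2 * E t := by ring
  rw [← key, abs_mul, abs_of_pos (by positivity : 0 < 2 * π)] at hbound
  have h2π : 1 ≤ 2 * π := by linarith [pi_gt_three]
  calc _ ≤ 2 * π * |normalDensity τ (x + v) + normalDensity τ (x - v)
        - 2 * normalDensity τ x| := le_mul_of_one_le_left (abs_nonneg _) h2π
    _ ≤ K / τ ^ 3 := hbound
    _ ≤ (K + 1) / τ ^ 3 := by gcongr; linarith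

/-- Averaging over a symmetric cell pairs v with -v, so only second differences enter. The resulting
order τ^{-3} matches the Fourier error in its power of n. -/
lemma exists_abs_normalDensity_sub_integral_le :
    ∃ C : ℝ, 0 < C ∧ ∀ τ : ℝ, 0 < τ → ∀ x : ℝ,
      |normalDensity τ x - ∫ y in (x - 1 / 2)..(x + 1 / 2), normalDensity τ y| ≤ C / τ ^ 3 := by
  obtain ⟨C, hC, hbound⟩ := exists_abs_second_difference_normalDensity_le
  refine ⟨C, hC, fun τ hτ x => ?_⟩
  have hc := continuous_normalDensity τ
  have e1 : ∫ y in (x - 1 / 2)..(x + 1 / 2), normalDensity τ y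
      = ∫ v in (-(1 / 2) : ℝ)..(1 / 2), normalDensity τ (x + v) := by
    rw [intervalIntegral.integral_comp_add_left, ← sub_eq_add_neg]
  have e2 : ∫ v in (-(1 / 2) : ℝ)..(1 / 2), normalDensity τ (x - v)
      = ∫ v in (-(1 / 2) : ℝ)..(1 / 2), normalDensity τ (x + v) := by
    rw [← e1, intervalIntegral.integral_comp_sub_left, sub_neg_eq_add]
  have i1 : IntervalIntegrable (fun v => normalDensity τ (x + v)) volume (-(1 / 2)) (1 / 2) :=
    (by fun_prop : Continuous _).intervalIntegrable _ _
  have i2 : IntervalIntegrable (fun v => normalDensity τ (x - v)) volume (-(1 / 2)) (1 / 2) :=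
    (by fun_prop : Continuous _).intervalIntegrable _ _
  have i3 : IntervalIntegrable (fun _ : ℝ => 2 * normalDensity τ x) volume (-(1 / 2)) (1 / 2) :=
    intervalIntegrable_const
  have key : ∫ v in (-(1 / 2) : ℝ)..(1 / 2),
      (normalDensity τ (x + v) + normalDensity τ (x - v) - 2 * normalDensity τ x)
      = 2 * ((∫ y in (x - 1 / 2)..(x + 1 / 2), normalDensity τ y) - normalDensity τ x) := by
    rw [intervalIntegral.integral_sub (i1.add i2) i3, intervalIntegral.integral_add i1 i2, e2,
      ← e1, intervalIntegral.integral_const, smul_eq_mul]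
    ring
  have h := intervalIntegral.norm_integral_le_of_norm_le_const (C := C / τ ^ 3)
    (a := -(1 / 2)) (b := 1 / 2)
    (f := fun v => normalDensity τ (x + v) + normalDensity τ (x - v) - 2 * normalDensity τ x)
    fun v hv => by
      rw [Set.uIoc_of_le (by norm_num)] at hv
      exact hbound τ hτ x v (abs_le.mpr ⟨by linarith [hv.1], by linarith [hv.2]⟩)
  rw [key, norm_eq_abs, abs_mul, abs_two, abs_sub_comm] at h
  norm_num at h ⊢
  have : 0 < C / τ ^ 3 := by positivity
  linarith

/-! ### Binary digits and the lattice variable 2^k Z(k) -/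

lemma residual_add_two (x : ℝ) (j : ℕ) : residual x (j + 2) = Int.fract (2 ^ (j + 1) * x) := by
  induction j with
  | zero => simp [residual]
  | succ j ih =>
    have e : (2 : ℝ) ^ (j + 2) * x
        = 2 * Int.fract (2 ^ (j + 1) * x) + ((2 * ⌊2 ^ (j + 1) * x⌋ : ℤ) : ℝ) := by
      push_cast
      rw [Int.fract]
      ring
    rw [show j + 1 + 2 = (j + 1) + 2 from rfl, residual, ih, show j + 1 + 1 = j + 2 from rfl, e,
      Int.fract_add_intCast]
    rfl

/-- The first bit ⌊2x⌋ carries the whole integer part, so the identity holds for every real x as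
soon as there is at least one round. With no rounds it would need ⌊x⌋ = 0. -/
lemma sum_bit_div_two_pow (x : ℝ) (k : ℕ) :
    ∑ l ∈ Finset.Icc 1 (k + 1), (bit x l : ℝ) / 2 ^ l = (⌊2 ^ (k + 1) * x⌋ : ℝ) / 2 ^ (k + 1) := by
  induction k with
  | zero => simp [bit, residual]
  | succ k ih =>
    have e : (2 : ℝ) ^ (k + 2) * x
        = 2 * Int.fract (2 ^ (k + 1) * x) + ((2 * ⌊2 ^ (k + 1) * x⌋ : ℤ) : ℝ) := by
      push_cast
      rw [Int.fract]
      ring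
    rw [Finset.sum_Icc_succ_top (by omega), ih, bit, residual_add_two,
      show k + 1 + 1 = k + 2 from rfl, e, Int.floor_add_intCast, pow_succ 2 (k + 1)]
    push_cast
    field_simp
    ring

variable {n : ℕ}

/-- The integer `2^k Z(k)`. -/
noncomputable def signedFloorSum (H : Finset (Fin n)) (k : ℕ) (x : Fin n → ℝ) : ℤ :=
  ∑ i, (if i ∈ H then 1 else -1) * ⌊2 ^ k * x i⌋

lemma sum_ite_one_neg_one_mul {R : Type*} [Ring R] (H : Finset (Fin n)) (f : Fin n → R) :
    ∑ i, (if i ∈ H then 1 else -1) * f i = ∑ i ∈ H, f i - ∑ i ∈ Hᶜ, f i := by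
  rw [← Finset.sum_add_sum_compl H, sub_eq_add_neg, ← Finset.sum_neg_distrib]
  congr 1
  · exact Finset.sum_congr rfl fun i hi => by simp [hi]
  · exact Finset.sum_congr rfl fun i hi => by simp [Finset.mem_compl.mp hi]

lemma partialSum_eq (H : Finset (Fin n)) (x : Fin n → ℝ) {k : ℕ} (hk : 1 ≤ k) :
    partialSum H x k = signedFloorSum H k x / 2 ^ k := by
  obtain ⟨k, rfl⟩ : ∃ j, k = j + 1 := ⟨k - 1, by omega⟩
  have h : ∀ s : Finset (Fin n),
      ∑ l ∈ Finset.Icc 1 (k + 1), ((∑ i ∈ s, bit (x i) l : ℤ) : ℝ) / 2 ^ l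
        = ((∑ i ∈ s, ⌊2 ^ (k + 1) * x i⌋ : ℤ) : ℝ) / 2 ^ (k + 1) := by
    intro s
    push_cast
    simp_rw [Finset.sum_div]
    rw [Finset.sum_comm]
    exact Finset.sum_congr rfl fun i _ => sum_bit_div_two_pow (x i) k
  rw [signedFloorSum, sum_ite_one_neg_one_mul, Int.cast_sub, sub_div, ← h, ← h,
    ← Finset.sum_sub_distrib]
  exact Finset.sum_congr rfl fun l _ => by rw [signedCount, Int.cast_sub, sub_div]

lemma measurable_signedFloorSum (H : Finset (Fin n)) (k : ℕ) :
    Measurable (signedFloorSum H k) := by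
  unfold signedFloorSum
  refine Finset.measurable_sum _ fun i _ => Measurable.const_mul ?_ _
  exact ((measurable_pi_apply i).const_mul _).floor

lemma measurableSet_signedFloorSum_eq (H : Finset (Fin n)) (k : ℕ) (s : ℤ) :
    MeasurableSet {x | signedFloorSum H k x = s} :=
  measurable_signedFloorSum H k (measurableSet_singleton s)

instance isProbabilityMeasure_restrict_Ico :
    IsProbabilityMeasure ((volume : Measure ℝ).restrict (Set.Ico 0 1)) :=
  ⟨by simp⟩

instance isProbabilityMeasure_obsLaw : IsProbabilityMeasure (obsLaw n) := by
  unfold obsLaw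
  infer_instance

/-! ### Characteristic function of the signed sum and Fourier inversion -/

lemma intervalIntegrable_cexp_floor (c : ℝ) (t a b : ℝ) :
    IntervalIntegrable (fun x : ℝ => Complex.exp (t * ⌊c * x⌋ * Complex.I)) volume a b := by
  refine (intervalIntegrable_const (c := (1 : ℝ))).mono_fun ?_ (Eventually.of_forall fun x => ?_)
  · refine Measurable.aestronglyMeasurable ?_
    have : Measurable fun x : ℝ => ((⌊c * x⌋ : ℤ) : ℂ) :=
      (measurable_from_top (f := fun z : ℤ => (z : ℂ))).comp (measurable_id.const_mul c).floor
    exact Complex.measurable_exp.comp ((this.const_mul _).mul_const _)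
  · have := Complex.norm_exp_ofReal_mul_I (t * ⌊c * x⌋)
    push_cast at this
    simp [this]

/-- Each half of [0, 1) is a rescaled copy of the previous level, the upper one shifted by 2^k. The
average of 1 and exp(i 2^k t) is a phase times the new cosine factor. -/
lemma integral_cexp_floor (k : ℕ) (t : ℝ) :
    ∫ x in (0 : ℝ)..1, Complex.exp (t * ⌊2 ^ k * x⌋ * Complex.I)
      = Complex.exp (t * ((2 ^ k - 1) / 2) * Complex.I) * cosProd k t := by
  induction k with
  | zero =>
    have h : ∫ x in (0 : ℝ)..1, Complex.exp (t * ⌊2 ^ 0 * x⌋ * Complex.I)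
        = ∫ x in (0 : ℝ)..1, (1 : ℂ) := by
      refine intervalIntegral.integral_congr_ae ?_
      have : ∀ᵐ x : ℝ, x ≠ 1 := by simp [ae_iff]
      filter_upwards [this] with x hx hx'
      rw [Set.uIoc_of_le zero_le_one] at hx'
      have : ⌊(2 : ℝ) ^ 0 * x⌋ = 0 := by
        rw [pow_zero, one_mul, Int.floor_eq_zero_iff]
        exact ⟨hx'.1.le, lt_of_le_of_ne hx'.2 hx⟩
      rw [this]
      simp
    rw [h]
    simp [cosProd]
  | succ k ih =>
    have h1 : ∫ x in (0 : ℝ)..(1 / 2), Complex.exp (t * ⌊2 ^ (k + 1) * x⌋ * Complex.I)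
        = (1 / 2 : ℝ) • ∫ y in (0 : ℝ)..1, Complex.exp (t * ⌊2 ^ k * y⌋ * Complex.I) := by
      have := intervalIntegral.integral_comp_mul_left (a := 0) (b := 1 / 2)
        (fun y : ℝ => Complex.exp (t * ⌊2 ^ k * y⌋ * Complex.I)) (two_ne_zero (α := ℝ))
      norm_num at this ⊢
      rw [← this]
      refine intervalIntegral.integral_congr fun x _ => ?_
      simp only [pow_succ, mul_assoc]
    have h2 : ∫ x in (1 / 2 : ℝ)..1, Complex.exp (t * ⌊2 ^ (k + 1) * x⌋ * Complex.I)
        = (1 / 2 : ℝ) • ∫ y in (0 : ℝ)..1, Complex.exp (t * 2 ^ k * Complex.I)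
          * Complex.exp (t * ⌊2 ^ k * y⌋ * Complex.I) := by
      have := intervalIntegral.integral_comp_mul_sub (a := 1 / 2) (b := 1)
        (fun y : ℝ => Complex.exp (t * 2 ^ k * Complex.I)
          * Complex.exp (t * ⌊2 ^ k * y⌋ * Complex.I)) (two_ne_zero (α := ℝ)) 1
      rw [show (2 : ℝ) * (1 / 2) - 1 = 0 by norm_num, show (2 : ℝ) * 1 - 1 = 1 by norm_num,
        ← one_div] at this
      rw [← this]
      refine intervalIntegral.integral_congr fun x _ => ?_
      have e : (2 : ℝ) ^ (k + 1) * x = 2 ^ k * (2 * x - 1) + ((2 ^ k : ℤ) : ℝ) := by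
        push_cast
        ring
      rw [e, Int.floor_add_intCast, ← Complex.exp_add]
      congr 1
      push_cast
      ring
    rw [← intervalIntegral.integral_add_adjacent_intervals
      (intervalIntegrable_cexp_floor _ _ 0 (1 / 2)) (intervalIntegrable_cexp_floor _ _ (1 / 2) 1),
      h1, h2, intervalIntegral.integral_const_mul, ih, cosProd_succ]
    push_cast
    rw [Complex.cos]
    simp only [Complex.real_smul]
    push_cast
    have e1 : Complex.exp (t * ((2 ^ (k + 1) - 1) / 2) * Complex.I)
        = Complex.exp (t * ((2 ^ k - 1) / 2) * Complex.I)
          * Complex.exp (2 ^ k * t / 2 * Complex.I) := by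
      rw [← Complex.exp_add]
      congr 1
      ring
    have e2 : Complex.exp (t * 2 ^ k * Complex.I)
        = Complex.exp (2 ^ k * t / 2 * Complex.I) * Complex.exp (2 ^ k * t / 2 * Complex.I) := by
      rw [← Complex.exp_add]
      congr 1
      ring
    have e3 : Complex.exp (2 ^ k * t / 2 * Complex.I)
        * Complex.exp (-(2 ^ k * t / 2) * Complex.I) = 1 := by
      rw [← Complex.exp_add]
      simp
    rw [e1, e2]
    linear_combination (-(1 / 2 : ℂ)) * Complex.exp (t * ((2 ^ k - 1) / 2) * Complex.I)
      * cosProd k t * e3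

/-- The mean of `signedFloorSum`. -/
noncomputable def signedFloorMean (H : Finset (Fin n)) (k : ℕ) : ℝ :=
  ((H.card : ℝ) - (n - H.card)) * ((2 ^ k - 1) / 2)

lemma sum_ite_mul_eq_signedFloorMean (H : Finset (Fin n)) (k : ℕ) :
    ∑ i : Fin n, (if i ∈ H then (1 : ℝ) else -1) * ((2 ^ k - 1) / 2) = signedFloorMean H k := by
  rw [sum_ite_one_neg_one_mul, Finset.sum_const, Finset.sum_const, Finset.card_compl,
    Fintype.card_fin, nsmul_eq_mul, nsmul_eq_mul,
    Nat.cast_sub (by simpa using Finset.card_le_univ H), signedFloorMean]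
  ring

/-- By independence the integral factors over the nodes. A weight -1 replaces t by -t, and `cosProd`
is even, so H enters only through the phase. -/
lemma integral_cexp_signedFloorSum (H : Finset (Fin n)) (k : ℕ) (t : ℝ) :
    ∫ x, Complex.exp (t * signedFloorSum H k x * Complex.I) ∂(obsLaw n)
      = Complex.exp (t * signedFloorMean H k * Complex.I) * cosProd k t ^ n := by
  have h1 : ∀ x : Fin n → ℝ, Complex.exp (t * signedFloorSum H k x * Complex.I)
      = ∏ i, Complex.exp (((if i ∈ H then t else -t : ℝ) : ℂ) * ⌊2 ^ k * x i⌋ * Complex.I) := by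
    intro x
    rw [← Complex.exp_sum, signedFloorSum]
    congr 1
    push_cast
    rw [Finset.mul_sum, Finset.sum_mul]
    refine Finset.sum_congr rfl fun i _ => ?_
    split_ifs <;> push_cast <;> ring
  have h2 : ∀ i : Fin n, ∫ x in Set.Ico (0 : ℝ) 1,
      Complex.exp (((if i ∈ H then t else -t : ℝ) : ℂ) * ⌊2 ^ k * x⌋ * Complex.I)
      = Complex.exp (t * (((if i ∈ H then (1 : ℝ) else -1) * ((2 ^ k - 1) / 2) : ℝ) : ℂ)
          * Complex.I) * cosProd k t := by
    intro i
    rw [integral_Ico_eq_integral_Ioo, ← integral_Ioc_eq_integral_Ioo,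
      ← intervalIntegral.integral_of_le zero_le_one, integral_cexp_floor]
    split_ifs
    · push_cast
      ring_nf
    · rw [cosProd_neg]
      push_cast
      ring_nf
  simp_rw [h1]
  rw [obsLaw, integral_fintype_prod_eq_prod (f := fun (i : Fin n) (y : ℝ) =>
    Complex.exp (((if i ∈ H then t else -t : ℝ) : ℂ) * ⌊2 ^ k * y⌋ * Complex.I))]
  simp_rw [h2]
  rw [Finset.prod_mul_distrib, ← Complex.exp_sum, Finset.prod_const, Finset.card_univ,
    Fintype.card_fin, ← Finset.sum_mul, ← Finset.mul_sum, ← sum_ite_mul_eq_signedFloorMean]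
  push_cast
  rfl

lemma integral_cos_signedFloorSum (H : Finset (Fin n)) (k : ℕ) (t s : ℝ) :
    ∫ x, cos (t * (signedFloorSum H k x - s)) ∂(obsLaw n)
      = cosProd k t ^ n * cos (t * (signedFloorMean H k - s)) := by
  have hi : Integrable (fun x => Complex.exp (t * signedFloorSum H k x * Complex.I)
      * Complex.exp (-(t * s) * Complex.I)) (obsLaw n) := by
    refine Integrable.of_bound (C := 1) ?_ (Eventually.of_forall fun x => ?_)
    · refine Measurable.aestronglyMeasurable ?_
      have : Measurable fun x => ((signedFloorSum H k x : ℤ) : ℂ) :=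
        (measurable_from_top (f := fun z : ℤ => (z : ℂ))).comp (measurable_signedFloorSum H k)
      exact (Complex.measurable_exp.comp ((this.const_mul _).mul_const _)).mul_const _
    · have h1 := Complex.norm_exp_ofReal_mul_I (t * signedFloorSum H k x)
      have h2 := Complex.norm_exp_ofReal_mul_I (-(t * s))
      push_cast at h1 h2
      rw [norm_mul, h1, h2, one_mul]
  have h := integral_re hi
  rw [integral_mul_const, integral_cexp_signedFloorSum] at h
  simp only [RCLike.re_eq_complex_re] at h
  have e1 : ∀ a : ℝ, (Complex.exp (t * a * Complex.I)
      * Complex.exp (-(t * s) * Complex.I)) = Complex.exp ((t * (a - s) : ℝ) * Complex.I) := by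
    intro a
    rw [← Complex.exp_add]
    congr 1
    push_cast
    ring
  have e2 : ∀ x, (signedFloorSum H k x : ℂ) = ((signedFloorSum H k x : ℝ) : ℂ) := fun x => by
    push_cast
    rfl
  simp_rw [e2, e1] at h
  rw [mul_right_comm, e1] at h
  simp_rw [Complex.exp_ofReal_mul_I_re] at h
  rw [h, ← Complex.ofReal_pow, Complex.re_mul_ofReal, Complex.exp_ofReal_mul_I_re, mul_comm]

lemma integral_cos_int_mul (m : ℤ) :
    ∫ t in (-π)..π, cos (t * m) = if m = 0 then 2 * π else 0 := by
  split_ifs with h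
  · simp [h]
    ring
  · have hm : (m : ℝ) ≠ 0 := by exact_mod_cast h
    rw [intervalIntegral.integral_comp_mul_right (fun x => cos x) hm, integral_cos]
    have : sin (π * m) = 0 := by rw [mul_comm]; exact sin_int_mul_pi m
    simp [this]

/-- Fourier inversion for the point masses of `signedFloorSum`. -/
lemma measureReal_signedFloorSum_eq (H : Finset (Fin n)) (k : ℕ) (s : ℤ) :
    (obsLaw n).real {x | signedFloorSum H k x = s}
      = (2 * π)⁻¹ * ∫ t in (-π)..π, cosProd k t ^ n * cos (t * (signedFloorMean H k - s)) := by
  have hle : -π ≤ π := by linarith [pi_pos]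
  have hi : Integrable (Function.uncurry fun (t : ℝ) (x : Fin n → ℝ) =>
      cos (t * (signedFloorSum H k x - s))) ((volume.restrict (Set.Ioc (-π) π)).prod (obsLaw n)) := by
    refine Integrable.of_bound (C := 1) ?_ (Eventually.of_forall fun p => abs_cos_le_one _)
    refine Measurable.aestronglyMeasurable ?_
    have : Measurable fun x => ((signedFloorSum H k x : ℤ) : ℝ) :=
      (measurable_from_top (f := fun z : ℤ => (z : ℝ))).comp (measurable_signedFloorSum H k)
    exact measurable_cos.comp (measurable_fst.mul ((this.comp measurable_snd).sub_const _))
  -- After the swap the inner integral over t is the orthogonality relation for integer frequencies.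
  have h := integral_integral_swap hi
  simp_rw [integral_cos_signedFloorSum, ← intervalIntegral.integral_of_le hle] at h
  rw [h]
  have e : ∀ x, ∫ t in (-π)..π, cos (t * (signedFloorSum H k x - s))
      = {x | signedFloorSum H k x = s}.indicator (fun _ => 2 * π) x := by
    intro x
    have := integral_cos_int_mul (signedFloorSum H k x - s)
    push_cast at this
    rw [this]
    simp [Set.indicator_apply, sub_eq_zero]
  simp_rw [e]
  rw [integral_indicator (measurableSet_signedFloorSum_eq H k s), setIntegral_const, smul_eq_mul]
  have := pi_pos
  field_simp

/-! ### Lattice points in the band -/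

/-- The number of integers in an open interval of length `n` starting at `c`. -/
noncomputable def latticeCount (n : ℕ) (c : ℝ) : ℕ := (⌈c + n⌉ - ⌊c⌋ - 1).toNat

lemma latticeCount_cast (hn : 1 ≤ n) (c : ℝ) :
    (latticeCount n c : ℝ) = ⌈c⌉ + n - ⌊c⌋ - 1 := by
  have h1 : ⌈c + n⌉ = ⌈c⌉ + n := by exact_mod_cast Int.ceil_add_natCast c n
  have h2 := Int.floor_le_ceil c
  have h3 : (latticeCount n c : ℤ) = ⌈c⌉ + n - ⌊c⌋ - 1 := by
    rw [latticeCount, h1, Int.toNat_of_nonneg (by omega)]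
  exact_mod_cast h3

lemma latticeCount_le (hn : 1 ≤ n) (c : ℝ) : latticeCount n c ≤ n := by
  have h1 := latticeCount_cast hn c
  have h2 : (⌈c⌉ : ℝ) ≤ ⌊c⌋ + 1 := by exact_mod_cast Int.ceil_le_floor_add_one c
  have : (latticeCount n c : ℝ) ≤ n := by linarith
  exact_mod_cast this

/-- Multiplication by 2^k turns the band into an open interval of length n, whatever k is. -/
lemma bandSet_eq (H : Finset (Fin n)) (a : ℝ) {k : ℕ} (hk : 1 ≤ k) :
    {x | lowerThr H a k < partialSum H x k ∧ partialSum H x k < upperThr H a k}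
      = ⋃ i ∈ Finset.range (latticeCount n (a * 2 ^ k - H.card)),
        {x | signedFloorSum H k x = ⌊a * 2 ^ k - H.card⌋ + 1 + i} := by
  ext x
  have h2 : (0 : ℝ) < 2 ^ k := by positivity
  simp only [Set.mem_ofPred_eq, Set.mem_iUnion, Finset.mem_range, exists_prop]
  rw [partialSum_eq H x hk, lowerThr, upperThr, lt_div_iff₀ h2, div_lt_iff₀ h2, sub_mul, add_mul,
    div_mul_cancel₀ _ h2.ne', div_mul_cancel₀ _ h2.ne', ← Int.floor_lt,
    show a * 2 ^ k + ((n : ℝ) - H.card) = (a * 2 ^ k - H.card) + n by ring, ← Int.lt_ceil,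
    latticeCount]
  constructor
  · rintro ⟨h3, h4⟩
    exact ⟨(signedFloorSum H k x - ⌊a * 2 ^ k - H.card⌋ - 1).toNat, by omega, by omega⟩
  · rintro ⟨i, h3, h4⟩
    omega

lemma measurableSet_band (H : Finset (Fin n)) (a : ℝ) {k : ℕ} (hk : 1 ≤ k) :
    MeasurableSet
      {x | lowerThr H a k < partialSum H x k ∧ partialSum H x k < upperThr H a k} := by
  rw [bandSet_eq H a hk]
  exact Finset.measurableSet_biUnion _ fun i _ => measurableSet_signedFloorSum_eq H k _

lemma toReal_bandProb (H : Finset (Fin n)) (a : ℝ) {k : ℕ} (hk : 1 ≤ k) :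
    (bandProb H a k).toReal = ∑ i ∈ Finset.range (latticeCount n (a * 2 ^ k - H.card)),
      (obsLaw n).real {x | signedFloorSum H k x = ⌊a * 2 ^ k - H.card⌋ + 1 + i} := by
  rw [bandProb, bandSet_eq H a hk]
  refine measureReal_biUnion_finset ?_ fun i _ => measurableSet_signedFloorSum_eq H k _
  intro i _ j _ hij
  refine Set.disjoint_left.mpr fun x hx hx' => hij ?_
  simp only [Set.mem_ofPred_eq] at hx hx'
  omega

/-! ### The Gaussian approximation as an integral of the density -/

lemma integral_normalDensity {τ : ℝ} (hτ : 0 < τ) (a b : ℝ) :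
    ∫ y in a..b, normalDensity τ y = 1 / 2 * (erf (b / (√2 * τ)) - erf (a / (√2 * τ))) := by
  have hs : 0 < √(2 : ℝ) := by positivity
  have hsq : √(2 : ℝ) ^ 2 = 2 := sq_sqrt (by norm_num)
  have h1 : ∀ y, normalDensity τ y = 1 / (τ * √(2 * π)) * exp (-(y / (√2 * τ)) ^ 2) := by
    intro y
    rw [normalDensity, div_pow, mul_pow, hsq]
    ring
  have hi : ∀ u v : ℝ, IntervalIntegrable (fun t : ℝ => exp (-t ^ 2)) volume u v := fun u v =>
    (by fun_prop : Continuous fun t : ℝ => exp (-t ^ 2)).intervalIntegrable _ _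
  simp_rw [h1]
  rw [intervalIntegral.integral_const_mul,
    intervalIntegral.integral_comp_div (fun t => exp (-t ^ 2)) (by positivity), erf, erf,
    ← mul_sub, intervalIntegral.integral_interval_sub_left (hi _ _) (hi _ _), smul_eq_mul,
    sqrt_mul (by norm_num)]
  have : 0 < √π := sqrt_pos.mpr pi_pos
  field_simp

lemma stdDev_mul_sq (n k : ℕ) : (2 ^ k * stdDev n k) ^ 2 = n * (4 ^ k - 1) / 12 := by
  have h1 : (1 : ℝ) / 4 ^ k ≤ 1 := by
    rw [div_le_one (by positivity)]
    exact one_le_pow₀ (by norm_num)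
  have h4 : ((2 : ℝ) ^ k) ^ 2 = 4 ^ k := by rw [← pow_mul, mul_comm, pow_mul]; norm_num
  have h0 : 0 ≤ (n : ℝ) * (1 - 1 / 4 ^ k) / 12 := by
    have : 0 ≤ 1 - (1 : ℝ) / 4 ^ k := by linarith
    positivity
  rw [mul_pow, stdDev, sq_sqrt h0, h4]
  field_simp

lemma le_stdDev {k : ℕ} (hk : 1 ≤ k) (n : ℕ) : √n / 4 ≤ stdDev n k := by
  have h4 : (4 : ℝ) ≤ 4 ^ k := le_self_pow₀ (by norm_num) (by omega)
  have h1 : (1 : ℝ) / 4 ^ k ≤ 1 / 4 := one_div_le_one_div_of_le (by norm_num) h4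
  have e : √(n : ℝ) / 4 = √(n / 16) := by
    rw [sqrt_div' _ (by norm_num)]
    congr 1
    rw [show (16 : ℝ) = 4 ^ 2 by norm_num, sqrt_sq (by norm_num)]
  rw [e, stdDev]
  refine sqrt_le_sqrt ?_
  have : (0 : ℝ) ≤ n := n.cast_nonneg
  nlinarith

lemma stdDev_pos {k : ℕ} (hk : 1 ≤ k) (hn : 1 ≤ n) : 0 < stdDev n k := by
  refine lt_of_lt_of_le ?_ (le_stdDev hk n)
  have : (0 : ℝ) < n := by exact_mod_cast hn
  positivity

lemma gaussApprox_eq_integral (hn : 1 ≤ n) {k : ℕ} (hk : 1 ≤ k) (γ : ℝ) :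
    gaussApprox n k γ = ∫ y in ((γ - 1 / 2 ^ (k + 1)) * n)..((γ + 1 / 2 ^ (k + 1)) * n),
      normalDensity (stdDev n k) y := by
  rw [integral_normalDensity (stdDev_pos hk hn), gaussApprox]

/-- In lattice units the centred band ends at 2^k n (γ ± 2^{-(k+1)}), and the factor 2^k cancels
against the standard deviation. -/
lemma gaussApprox_eq_integral_lattice (hn : 1 ≤ n) {k : ℕ} (hk : 1 ≤ k) (H : Finset (Fin n))
    (α β : ℝ) (hβ : (H.card : ℝ) = β * n) :
    gaussApprox n k (α + (1 / 2 - β))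
      = ∫ y in (α * n * 2 ^ k - H.card - signedFloorMean H k)..
          (α * n * 2 ^ k - H.card + n - signedFloorMean H k),
        normalDensity (2 ^ k * stdDev n k) y := by
  have hs := stdDev_pos hk hn
  have h2 : (0 : ℝ) < 2 ^ k := by positivity
  rw [integral_normalDensity (by positivity), gaussApprox, signedFloorMean, hβ, pow_succ]
  congr 3 <;> (field_simp; ring)

lemma gaussApprox_nonneg (hn : 1 ≤ n) {k : ℕ} (hk : 1 ≤ k) (γ : ℝ) : 0 ≤ gaussApprox n k γ := by
  rw [gaussApprox_eq_integral hn hk]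
  refine intervalIntegral.integral_nonneg ?_ fun y _ => normalDensity_nonneg (stdDev_pos hk hn) y
  have : (0 : ℝ) < 1 / 2 ^ (k + 1) := by positivity
  gcongr
  linarith

/-! ### Local limit theorem and the error in one round -/

lemma exists_abs_pointMass_sub_le :
    ∃ C : ℝ, 0 < C ∧ ∀ (n k : ℕ) (H : Finset (Fin n)) (s : ℤ), 2 ≤ n → 1 ≤ k →
      |(obsLaw n).real {x | signedFloorSum H k x = s}
        - ∫ y in (s - signedFloorMean H k - 1 / 2)..(s - signedFloorMean H k + 1 / 2),
          normalDensity (2 ^ k * stdDev n k) y| ≤ C / (2 ^ k * (n * √n)) := by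
  obtain ⟨C₁, hC₁, h₁⟩ := exists_abs_integral_cosProd_pow_sub_le
  obtain ⟨C₂, hC₂, h₂⟩ := exists_abs_normalDensity_sub_integral_le
  -- 64 = 4³ comes from τ ≥ 2^k √n / 4.
  refine ⟨C₁ + 64 * C₂, by positivity, fun n k H s hn hk => ?_⟩
  set τ := 2 ^ k * stdDev n k with hτ
  have hn0 : (0 : ℝ) < n := by exact_mod_cast (by omega : 0 < n)
  have hsn : 0 < √(n : ℝ) := sqrt_pos.mpr hn0
  have hss : √(n : ℝ) ^ 2 = n := sq_sqrt hn0.le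
  have hτ0 : 0 < τ := mul_pos (by positivity) (stdDev_pos hk (by omega))
  have hτ1 : 2 ^ k * √n / 4 ≤ τ := by
    rw [hτ, mul_div_assoc]
    gcongr
    exact le_stdDev hk n
  have hτ3 : C₂ / τ ^ 3 ≤ 64 * C₂ / (2 ^ k * (n * √n)) := by
    rw [div_le_div_iff₀ (by positivity) (by positivity)]
    have h1 : (1 : ℝ) ≤ 2 ^ k := one_le_pow₀ (by norm_num)
    have h2 : (2 : ℝ) ^ k ≤ (2 ^ k) ^ 3 := le_self_pow₀ h1 (by norm_num)
    calc C₂ * (2 ^ k * (n * √n)) ≤ C₂ * ((2 ^ k) ^ 3 * (√n ^ 2 * √n)) := by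
          rw [hss]
          gcongr
      _ = 64 * C₂ * (2 ^ k * √n / 4) ^ 3 := by ring
      _ ≤ 64 * C₂ * τ ^ 3 := by gcongr
  have hG : ∫ t : ℝ, exp (-((4 ^ k - 1) / 24 * t ^ 2)) ^ n * cos (t * (signedFloorMean H k - s))
      = 2 * π * normalDensity τ (s - signedFloorMean H k) := by
    rw [← integral_exp_mul_cos hτ0]
    congr 1
    ext t
    rw [← exp_nat_mul, hτ, stdDev_mul_sq, ← cos_neg]
    congr 2 <;> ring
  have e1 := h₁ k n hk hn (signedFloorMean H k - s)
  rw [hG] at e1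
  have e2 := h₂ τ hτ0 (s - signedFloorMean H k)
  rw [measureReal_signedFloorSum_eq]
  set I := ∫ t in (-π)..π, cosProd k t ^ n * cos (t * (signedFloorMean H k - s))
  set d := normalDensity τ (s - signedFloorMean H k)
  have e3 : |(2 * π)⁻¹ * I - d| ≤ C₁ / (2 ^ k * (n * √n)) := by
    have hπ : 1 ≤ 2 * π := by linarith [pi_gt_three]
    have e4 : (2 * π)⁻¹ * I - d = (2 * π)⁻¹ * (I - 2 * π * d) := by
      have := pi_pos
      field_simp
    rw [e4, abs_mul, abs_of_pos (by positivity)]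
    exact (mul_le_of_le_one_left (abs_nonneg _) (inv_le_one_of_one_le₀ hπ)).trans e1
  refine (abs_sub_le _ d _).trans ?_
  calc _ ≤ C₁ / (2 ^ k * (n * √n)) + C₂ / τ ^ 3 := add_le_add e3 e2
    _ ≤ C₁ / (2 ^ k * (n * √n)) + 64 * C₂ / (2 ^ k * (n * √n)) := by gcongr
    _ = _ := by ring

lemma abs_integral_normalDensity_le {τ : ℝ} (hτ : 0 < τ) (a b : ℝ) :
    |∫ y in a..b, normalDensity τ y| ≤ |b - a| / τ := by
  have := intervalIntegral.norm_integral_le_of_norm_le_const (a := a) (b := b) (C := 1 / τ)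
    (f := normalDensity τ) fun y _ => by
      rw [norm_eq_abs, abs_of_nonneg (normalDensity_nonneg hτ y)]
      exact normalDensity_le hτ y
  rw [norm_eq_abs] at this
  refine this.trans (le_of_eq ?_)
  ring

/-- The error of the Gaussian approximation in round `k` is `O(2^{-k} n^{-1/2})`, uniformly. -/
lemma exists_abs_cltError_le :
    ∃ C : ℝ, 0 < C ∧ ∀ (n k : ℕ) (H : Finset (Fin n)) (α β : ℝ), 2 ≤ n → 1 ≤ k →
      (H.card : ℝ) = β * n → |cltError H α β k| ≤ C / √n * (1 / 2) ^ k := by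
  obtain ⟨C, hC, hpt⟩ := exists_abs_pointMass_sub_le
  refine ⟨C + 4, by positivity, fun n k H α β hn hk hβ => ?_⟩
  have hn1 : 1 ≤ n := by omega
  have hn0 : (0 : ℝ) < n := by exact_mod_cast hn1
  have hsn : 0 < √(n : ℝ) := sqrt_pos.mpr hn0
  have hτ0 : 0 < 2 ^ k * stdDev n k := mul_pos (by positivity) (stdDev_pos hk hn1)
  have hτ1 : 2 ^ k * √n / 4 ≤ 2 ^ k * stdDev n k := by
    rw [mul_div_assoc]
    gcongr
    exact le_stdDev hk n
  rw [cltError, toReal_bandProb H _ hk, gaussApprox_eq_integral_lattice hn1 hk H α β hβ]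
  set τ := 2 ^ k * stdDev n k
  set c := α * n * 2 ^ k - H.card
  set μ := signedFloorMean H k
  set N' := latticeCount n c with hN'
  have hcont := continuous_normalDensity τ
  have hi : ∀ a b, IntervalIntegrable (normalDensity τ) volume a b := fun a b =>
    hcont.intervalIntegrable a b
  -- Endpoints of the unit cells centred at the lattice points of the band, after subtracting the
  -- mean. The outermost ones, `p 0` and `p N'`, lie within 1/2 of the ends of the band, so each end
  -- costs at most 1 / (2τ).
  set p : ℕ → ℝ := fun i => ⌊c⌋ + 1 / 2 + i - μ with hp
  have hsum : ∑ i ∈ Finset.range N', ∫ y in (p i)..(p (i + 1)), normalDensity τ y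
      = ∫ y in (p 0)..(p N'), normalDensity τ y :=
    intervalIntegral.sum_integral_adjacent_intervals fun _ _ => hi _ _
  have hdiff : |∑ i ∈ Finset.range N', (obsLaw n).real {x | signedFloorSum H k x = ⌊c⌋ + 1 + i}
      - ∫ y in (p 0)..(p N'), normalDensity τ y| ≤ n * (C / (2 ^ k * (n * √n))) := by
    rw [← hsum, ← Finset.sum_sub_distrib]
    refine (Finset.abs_sum_le_sum_abs _ _).trans ?_
    calc _ ≤ ∑ i ∈ Finset.range N', C / (2 ^ k * (n * √n)) := by
          refine Finset.sum_le_sum fun i _ => ?_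
          have := hpt n k H (⌊c⌋ + 1 + i) hn hk
          have e1 : (((⌊c⌋ + 1 + i : ℤ) : ℝ) - μ - 1 / 2) = p i := by
            simp only [hp]
            push_cast
            ring
          have e2 : (((⌊c⌋ + 1 + i : ℤ) : ℝ) - μ + 1 / 2) = p (i + 1) := by
            simp only [hp]
            push_cast
            ring
          rwa [e1, e2] at this
      _ = N' * (C / (2 ^ k * (n * √n))) := by
          rw [Finset.sum_const, Finset.card_range, nsmul_eq_mul]
      _ ≤ _ := by
          gcongr
          exact latticeCount_le hn1 c
  have hsplit : ∫ y in (c - μ)..(c + n - μ), normalDensity τ y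
      = (∫ y in (c - μ)..(p 0), normalDensity τ y) + (∫ y in (p 0)..(p N'), normalDensity τ y)
        + ∫ y in (p N')..(c + n - μ), normalDensity τ y := by
    rw [intervalIntegral.integral_add_adjacent_intervals (hi _ _) (hi _ _),
      intervalIntegral.integral_add_adjacent_intervals (hi _ _) (hi _ _)]
  have hN'c := latticeCount_cast hn1 c
  rw [← hN'] at hN'c
  have hb1 : |∫ y in (c - μ)..(p 0), normalDensity τ y| ≤ 1 / 2 / τ := by
    refine (abs_integral_normalDensity_le hτ0 _ _).trans ?_
    gcongr
    simp only [hp, Nat.cast_zero]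
    rw [abs_le]
    constructor <;> linarith [Int.floor_le c, Int.lt_floor_add_one c]
  have hb2 : |∫ y in (p N')..(c + n - μ), normalDensity τ y| ≤ 1 / 2 / τ := by
    refine (abs_integral_normalDensity_le hτ0 _ _).trans ?_
    gcongr
    simp only [hp, hN'c]
    rw [abs_le]
    constructor <;> linarith [Int.le_ceil c, Int.ceil_lt_add_one c]
  have hτ2 : 1 / τ ≤ 4 / (2 ^ k * √n) := by
    rw [div_le_div_iff₀ hτ0 (by positivity)]
    linarith
  rw [hsplit]
  set S := ∑ i ∈ Finset.range N', (obsLaw n).real {x | signedFloorSum H k x = ⌊c⌋ + 1 + i}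
  set I0 := ∫ y in (p 0)..(p N'), normalDensity τ y
  set I1 := ∫ y in (c - μ)..(p 0), normalDensity τ y
  set I2 := ∫ y in (p N')..(c + n - μ), normalDensity τ y
  calc |S - (I1 + I0 + I2)| ≤ n * (C / (2 ^ k * (n * √n))) + 1 / 2 / τ + 1 / 2 / τ := by
        rw [abs_le] at *
        constructor <;> linarith [hdiff.1, hdiff.2, hb1.1, hb1.2, hb2.1, hb2.2]
    _ = C / (2 ^ k * √n) + 1 / τ := by
        field_simp
        ring
    _ ≤ C / (2 ^ k * √n) + 4 / (2 ^ k * √n) := by gcongr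
    _ = (C + 4) / √n * (1 / 2) ^ k := by
        rw [one_div, inv_pow]
        field_simp

/-! ### Summability for each fixed n -/

lemma integral_abs_cosProd_le (k : ℕ) :
    ∫ t in (0 : ℝ)..π, |cosProd k t| ≤ 2 * π / √(2 ^ k) := by
  have h2 : (0 : ℝ) < 2 ^ k := by positivity
  have hint : IntervalIntegrable (fun t : ℝ => √(π / 2 ^ k) * t ^ (-(1 / 2) : ℝ)) volume 0 π :=
    (intervalIntegral.intervalIntegrable_rpow' (by norm_num)).const_mul _
  have h1 : ∫ t in (0 : ℝ)..π, |cosProd k t|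
      ≤ ∫ t in (0 : ℝ)..π, √(π / 2 ^ k) * t ^ (-(1 / 2) : ℝ) := by
    refine intervalIntegral.integral_mono_on_of_le_Ioo pi_pos.le
      ((continuous_cosProd k).abs.intervalIntegrable _ _) hint fun t ht => ?_
    have hf := abs_cosProd_le_div k ht.1.ne' (by rw [abs_of_pos ht.1]; exact ht.2.le)
    rw [abs_of_pos ht.1] at hf
    have hf1 := abs_cosProd_le_one k t
    have h0 := abs_nonneg (cosProd k t)
    rw [rpow_neg ht.1.le, ← sqrt_eq_rpow, ← div_eq_mul_inv, ← sqrt_div' _ ht.1.le, div_div]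
    -- |f| ≤ 1 and |f| ≤ π / (2^k t) give f² ≤ π / (2^k t), whose square root is integrable at 0.
    refine le_sqrt_of_sq_le ?_
    nlinarith
  refine h1.trans (le_of_eq ?_)
  rw [intervalIntegral.integral_const_mul, integral_rpow (Or.inl (by norm_num))]
  norm_num
  rw [← sqrt_eq_rpow]
  have hs : √π ^ 2 = π := sq_sqrt pi_pos.le
  field_simp
  rw [hs]

/-- Only one of the n factors is kept. The decay 2^{-k/2} is weak, but it also covers n = 1, where
the local limit theorem is not available. -/
lemma measureReal_signedFloorSum_le (hn : 1 ≤ n) (H : Finset (Fin n)) (k : ℕ) (s : ℤ) :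
    (obsLaw n).real {x | signedFloorSum H k x = s} ≤ 2 / √(2 ^ k) := by
  have hc := (continuous_cosProd k).abs
  have hle : -π ≤ π := by linarith [pi_pos]
  have h1 : |∫ t in (-π)..π, cosProd k t ^ n * cos (t * (signedFloorMean H k - s))|
      ≤ ∫ t in (-π)..π, |cosProd k t| := by
    rw [← norm_eq_abs]
    refine intervalIntegral.norm_integral_le_of_norm_le hle (Eventually.of_forall fun t _ => ?_)
      (hc.intervalIntegrable _ _)
    rw [norm_mul, norm_pow, norm_eq_abs, norm_eq_abs]
    calc |cosProd k t| ^ n * |cos (t * (signedFloorMean H k - s))| ≤ |cosProd k t| ^ 1 * 1 := by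
          refine mul_le_mul ?_ (abs_cos_le_one _) (abs_nonneg _) (by positivity)
          exact pow_le_pow_of_le_one (abs_nonneg _) (abs_cosProd_le_one k t) hn
      _ = |cosProd k t| := by ring
  have h2 : ∫ t in (-π)..π, |cosProd k t| = 2 * ∫ t in (0 : ℝ)..π, |cosProd k t| := by
    have h3 : ∫ t in (-π)..0, |cosProd k t| = ∫ t in (0 : ℝ)..π, |cosProd k t| := by
      have := intervalIntegral.integral_comp_neg (a := 0) (b := π) (fun t => |cosProd k t|)
      simp only [cosProd_neg, neg_zero] at this
      exact this.symm
    rw [← intervalIntegral.integral_add_adjacent_intervals (hc.intervalIntegrable _ 0)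
      (hc.intervalIntegrable _ _), h3]
    ring
  have h4 := integral_abs_cosProd_le k
  rw [measureReal_signedFloorSum_eq]
  have hπ := pi_pos
  calc _ ≤ (2 * π)⁻¹ * (2 * (2 * π / √(2 ^ k))) := by
        gcongr
        exact (le_abs_self _).trans (h1.trans (h2.le.trans (by linarith)))
    _ = 2 / √(2 ^ k) := by field_simp

lemma toReal_bandProb_le (hn : 1 ≤ n) (H : Finset (Fin n)) (a : ℝ) {k : ℕ} (hk : 1 ≤ k) :
    (bandProb H a k).toReal ≤ n * (2 / √(2 ^ k)) := by
  rw [toReal_bandProb H a hk]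
  calc _ ≤ ∑ i ∈ Finset.range (latticeCount n (a * 2 ^ k - H.card)), 2 / √(2 ^ k) :=
        Finset.sum_le_sum fun i _ => measureReal_signedFloorSum_le hn H k _
    _ = latticeCount n (a * 2 ^ k - H.card) * (2 / √(2 ^ k)) := by
        rw [Finset.sum_const, Finset.card_range, nsmul_eq_mul]
    _ ≤ _ := by
        gcongr
        exact latticeCount_le hn _

lemma summable_bandProb (hn : 1 ≤ n) (H : Finset (Fin n)) (a : ℝ) :
    Summable fun k : ℕ => (bandProb H a (k + 1)).toReal := by
  have h1 : 1 < √(2 : ℝ) := by rw [lt_sqrt (by norm_num)]; norm_num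
  have hs : Summable fun k : ℕ => (n : ℝ) * 2 * (1 / √2) ^ (k + 1) := by
    refine Summable.mul_left _ ((summable_nat_add_iff 1).mpr ?_)
    exact summable_geometric_of_lt_one (by positivity) ((div_lt_one (by positivity)).mpr h1)
  refine hs.of_nonneg_of_le (fun k => ENNReal.toReal_nonneg) fun k => ?_
  refine (toReal_bandProb_le hn H a (by omega)).trans (le_of_eq ?_)
  have : √((2 : ℝ) ^ (k + 1)) = √2 ^ (k + 1) := by
    rw [sqrt_eq_iff_eq_sq (by positivity) (by positivity), ← pow_mul, mul_comm, pow_mul,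
      sq_sqrt (by norm_num)]
  rw [this, one_div, inv_pow]
  ring

lemma gaussApprox_le (hn : 1 ≤ n) {k : ℕ} (hk : 1 ≤ k) (γ : ℝ) :
    gaussApprox n k γ ≤ 4 * √n * (1 / 2) ^ k := by
  have hs := stdDev_pos hk hn
  have hn0 : (0 : ℝ) < n := by exact_mod_cast hn
  have hsn : 0 < √(n : ℝ) := sqrt_pos.mpr hn0
  rw [gaussApprox_eq_integral hn hk]
  refine (le_abs_self _).trans ((abs_integral_normalDensity_le hs _ _).trans ?_)
  have e : (γ + 1 / 2 ^ (k + 1)) * n - (γ - 1 / 2 ^ (k + 1)) * n = (1 / 2) ^ k * n := by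
    rw [pow_succ, one_div_pow]
    field_simp
    ring
  rw [e, abs_of_pos (by positivity)]
  calc (1 / 2 : ℝ) ^ k * n / stdDev n k ≤ (1 / 2) ^ k * n / (√n / 4) := by
        gcongr
        exact le_stdDev hk n
    _ = 4 * √n * (1 / 2) ^ k := by
        rw [div_eq_iff (by positivity)]
        linear_combination (-(1 / 2 : ℝ) ^ k) * sq_sqrt hn0.le

lemma summable_gaussApprox (hn : 1 ≤ n) (γ : ℝ) :
    Summable fun k : ℕ => gaussApprox n (k + 1) γ := by
  have hs : Summable fun k : ℕ => 4 * √(n : ℝ) * (1 / 2 : ℝ) ^ (k + 1) :=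
    Summable.mul_left _ ((summable_nat_add_iff 1).mpr
      (summable_geometric_of_lt_one (by norm_num) (by norm_num)))
  exact hs.of_nonneg_of_le (fun k => gaussApprox_nonneg hn (by omega) γ)
    fun k => gaussApprox_le hn (by omega) γ

/-! ### Limit of the Gaussian series -/

lemma erf_zero : erf 0 = 0 := by simp [erf]

lemma erf_neg (x : ℝ) : erf (-x) = -erf x := by
  have h := intervalIntegral.integral_comp_neg (a := 0) (b := x) fun t => exp (-t ^ 2)
  simp only [neg_sq, neg_zero] at h
  rw [erf, erf, h, intervalIntegral.integral_symm]
  ring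

lemma tendsto_erf_atTop : Tendsto erf atTop (𝓝 1) := by
  have hi : Integrable fun t : ℝ => exp (-t ^ 2) := by
    simpa using integrable_exp_neg_mul_sq (b := 1) one_pos
  have h := (intervalIntegral_tendsto_integral_Ioi 0 hi.integrableOn tendsto_id).const_mul
    (2 / √π)
  have hg := integral_gaussian_Ioi 1
  simp only [neg_mul, one_mul, div_one] at hg
  have hπ : 0 < √π := sqrt_pos.mpr pi_pos
  have e : 2 / √π * (√π / 2) = 1 := by field_simp
  rw [hg, e] at h
  exact h

lemma tendsto_erf_atBot : Tendsto erf atBot (𝓝 (-1)) := by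
  have h := (tendsto_erf_atTop.comp tendsto_neg_atBot_atTop).neg
  refine h.congr fun x => ?_
  simp [erf_neg]

lemma erf_mono : Monotone erf := by
  intro x y hxy
  have hi : ∀ u v : ℝ, IntervalIntegrable (fun t : ℝ => exp (-t ^ 2)) volume u v := fun u v =>
    (by fun_prop : Continuous fun t : ℝ => exp (-t ^ 2)).intervalIntegrable _ _
  unfold erf
  gcongr
  rw [← sub_nonneg, intervalIntegral.integral_interval_sub_left (hi _ _) (hi _ _)]
  exact intervalIntegral.integral_nonneg hxy fun t _ => (exp_pos _).le

lemma erf_le_one (x : ℝ) : erf x ≤ 1 := erf_mono.ge_of_tendsto tendsto_erf_atTop x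

lemma neg_one_le_erf (x : ℝ) : -1 ≤ erf x := erf_mono.le_of_tendsto tendsto_erf_atBot x

lemma gaussApprox_le_one (n k : ℕ) (γ : ℝ) : gaussApprox n k γ ≤ 1 := by
  unfold gaussApprox
  linarith [erf_le_one ((γ + 1 / 2 ^ (k + 1)) * n / (√2 * stdDev n k)),
    neg_one_le_erf ((γ - 1 / 2 ^ (k + 1)) * n / (√2 * stdDev n k))]

/-- For fixed k the argument of `erf` is a fixed multiple of d √n, so its limit depends only on the
sign of d. -/
lemma exists_mul_div_stdDev_eq {k : ℕ} (hk : 1 ≤ k) :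
    ∃ c : ℝ, 0 < c ∧ ∀ (n : ℕ) (d : ℝ), d * n / (√2 * stdDev n k) = d * (c * √n) := by
  have h4 : (4 : ℝ) ≤ 4 ^ k := le_self_pow₀ (by norm_num) (by omega)
  have h1 : (1 : ℝ) / 4 ^ k ≤ 1 / 4 := one_div_le_one_div_of_le (by norm_num) h4
  have hv : 0 < (1 - 1 / 4 ^ k : ℝ) / 12 := by linarith
  have hs := sqrt_pos.mpr hv
  refine ⟨(√2 * √((1 - 1 / 4 ^ k : ℝ) / 12))⁻¹, by positivity, fun n d => ?_⟩
  have e : stdDev n k = √n * √((1 - 1 / 4 ^ k : ℝ) / 12) := by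
    rw [stdDev, mul_div_assoc, sqrt_mul n.cast_nonneg]
  rw [e]
  generalize √((1 - 1 / 4 ^ k : ℝ) / 12) = v at hs
  rcases Nat.eq_zero_or_pos n with rfl | hn
  · simp
  · have hn0 : (0 : ℝ) < n := by exact_mod_cast hn
    have hsn : 0 < √(n : ℝ) := sqrt_pos.mpr hn0
    have h2 : 0 < √(2 : ℝ) := by positivity
    rw [div_eq_iff (by positivity)]
    field_simp
    rw [sq_sqrt hn0.le]

lemma tendsto_sqrt_natCast {N : ℕ → ℕ} (hN : Tendsto N atTop atTop) :
    Tendsto (fun j => √(N j : ℝ)) atTop atTop :=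
  tendsto_sqrt_atTop.comp (tendsto_natCast_atTop_atTop.comp hN)

lemma tendsto_erf_mul {k : ℕ} (hk : 1 ≤ k) {N : ℕ → ℕ} (hN : Tendsto N atTop atTop) (d : ℝ) :
    Tendsto (fun j => erf (d * N j / (√2 * stdDev (N j) k))) atTop
      (𝓝 (if 0 < d then 1 else if d = 0 then 0 else -1)) := by
  obtain ⟨c, hc, hcd⟩ := exists_mul_div_stdDev_eq hk
  simp_rw [hcd]
  have h := (tendsto_sqrt_natCast hN).const_mul_atTop hc
  rcases lt_trichotomy d 0 with hd | hd | hd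
  · rw [if_neg hd.not_gt, if_neg hd.ne]
    exact tendsto_erf_atBot.comp (h.const_mul_atTop_of_neg hd)
  · simp [hd, erf_zero]
  · rw [if_pos hd]
    exact tendsto_erf_atTop.comp (h.const_mul_atTop hd)

lemma exists_tendsto_gaussApprox {k : ℕ} (hk : 1 ≤ k) {N : ℕ → ℕ} (hN : Tendsto N atTop atTop)
    (γ : ℝ) : ∃ l : ℝ, Tendsto (fun j => gaussApprox (N j) k γ) atTop (𝓝 l) :=
  ⟨_, ((tendsto_erf_mul hk hN (γ + 1 / 2 ^ (k + 1))).sub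
    (tendsto_erf_mul hk hN (γ - 1 / 2 ^ (k + 1)))).const_mul (1 / 2)⟩

lemma tendsto_gaussApprox_zero {k : ℕ} (hk : 1 ≤ k) {N : ℕ → ℕ} (hN : Tendsto N atTop atTop) :
    Tendsto (fun j => gaussApprox (N j) k 0) atTop (𝓝 1) := by
  have h := ((tendsto_erf_mul hk hN (0 + 1 / 2 ^ (k + 1))).sub
    (tendsto_erf_mul hk hN (0 - 1 / 2 ^ (k + 1)))).const_mul (1 / 2)
  have hp : (0 : ℝ) < 1 / 2 ^ (k + 1) := by positivity
  rw [if_pos (by linarith), if_neg (by linarith), if_neg (by linarith)] at h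
  norm_num at h
  simpa [gaussApprox] using h

lemma normalDensity_le_div_sq {τ : ℝ} (hτ : 0 < τ) {y : ℝ} (hy : y ≠ 0) :
    normalDensity τ y ≤ 2 * τ / y ^ 2 := by
  have hy2 : 0 < y ^ 2 := by positivity
  have h1 : 1 ≤ √(2 * π) := one_le_sqrt.mpr (by linarith [pi_gt_three])
  have h2 : exp (-(y ^ 2 / (2 * τ ^ 2))) ≤ 2 * τ ^ 2 / y ^ 2 := by
    rw [exp_neg, ← inv_div (y ^ 2)]
    refine inv_anti₀ (by positivity) ?_
    linarith [add_one_le_exp (y ^ 2 / (2 * τ ^ 2))]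
  calc normalDensity τ y ≤ 2 * τ ^ 2 / y ^ 2 / (τ * 1) := by
        unfold normalDensity
        gcongr
    _ = 2 * τ / y ^ 2 := by field_simp

lemma stdDev_le (hn : 1 ≤ n) (k : ℕ) : stdDev n k ≤ n := by
  have hn1 : (1 : ℝ) ≤ n := by exact_mod_cast hn
  have h1 : (0 : ℝ) < 1 / 4 ^ k := by positivity
  rw [stdDev, sqrt_le_left (by linarith)]
  nlinarith

/-- A majorant free of n, unlike `gaussApprox_le`. With h = 2^{-(k+1)}: if |γ| ≤ 2h, the trivial
bound 1 is enough. Otherwise the interval, of length 2hn, stays at distance at least |γ| n / 2 from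
0, where the density is at most 8 / (γ² n). -/
lemma gaussApprox_le_of_ne_zero (hn : 1 ≤ n) {k : ℕ} (hk : 1 ≤ k) {γ : ℝ} (hγ : γ ≠ 0) :
    gaussApprox n k γ ≤ (2 / |γ| + 16 / γ ^ 2) * (1 / 2) ^ (k + 1) := by
  have hγ0 : 0 < |γ| := abs_pos.mpr hγ
  have hγ2 : 0 < γ ^ 2 := by positivity
  have hn0 : (0 : ℝ) < n := by exact_mod_cast hn
  have hs := stdDev_pos hk hn
  set h : ℝ := (1 / 2) ^ (k + 1) with hh
  have hh0 : 0 < h := by positivity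
  have hh' : (1 : ℝ) / 2 ^ (k + 1) = h := by rw [hh, one_div_pow]
  rw [add_mul]
  rcases le_or_gt |γ| (2 * h) with hle | hlt
  · have h1 : 1 ≤ 2 / |γ| * h := by
      rw [div_mul_eq_mul_div, le_div_iff₀ hγ0]
      linarith
    have h2 : 0 ≤ 16 / γ ^ 2 * h := by positivity
    linarith [gaussApprox_le_one n k γ]
  · have h1 : 0 ≤ 2 / |γ| * h := by positivity
    suffices hsuff : gaussApprox n k γ ≤ 16 / γ ^ 2 * h by linarith
    rw [gaussApprox_eq_integral hn hk, hh']
    have hbd : ∀ y ∈ Set.uIoc ((γ - h) * n) ((γ + h) * n),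
        ‖normalDensity (stdDev n k) y‖ ≤ 8 / (γ ^ 2 * n) := by
      intro y hy
      rw [Set.uIoc_of_le (by gcongr; linarith)] at hy
      have hy1 : |γ| * n / 2 ≤ |y| := by
        rcases lt_or_gt_of_ne hγ with hneg | hpos
        · rw [abs_of_neg hneg] at hlt ⊢
          refine le_trans ?_ (neg_le_abs y)
          nlinarith [hy.2]
        · rw [abs_of_pos hpos] at hlt ⊢
          refine le_trans ?_ (le_abs_self y)
          nlinarith [hy.1]
      have hy0 : 0 < |γ| * n / 2 := by positivity
      have hy2 : (|γ| * n / 2) ^ 2 ≤ y ^ 2 := by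
        rw [← sq_abs y]
        gcongr
      rw [norm_eq_abs, abs_of_nonneg (normalDensity_nonneg hs y)]
      calc normalDensity (stdDev n k) y ≤ 2 * stdDev n k / y ^ 2 :=
            normalDensity_le_div_sq hs (abs_pos.mp (hy0.trans_le hy1))
        _ ≤ 2 * n / (|γ| * n / 2) ^ 2 := by
            gcongr
            exact stdDev_le hn k
        _ = 8 / (γ ^ 2 * n) := by
            rw [div_pow, mul_pow, sq_abs]
            field_simp
            norm_num
    refine (le_norm_self _).trans
      ((intervalIntegral.norm_integral_le_of_norm_le_const hbd).trans (le_of_eq ?_))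
    rw [show (γ + h) * n - (γ - h) * n = 2 * h * n by ring, abs_of_pos (by positivity)]
    field_simp
    norm_num

lemma exists_tendsto_tsum_gaussApprox {N : ℕ → ℕ} (hpos : ∀ j, 0 < N j)
    (hN : Tendsto N atTop atTop) {γ : ℝ} (hγ : γ ≠ 0) :
    ∃ s : ℝ, Tendsto (fun j => ∑' k : ℕ, gaussApprox (N j) (k + 1) γ) atTop (𝓝 s) := by
  choose l hl using fun k : ℕ => exists_tendsto_gaussApprox (k := k + 1) (by omega) hN γ
  refine ⟨∑' k, l k, tendsto_tsum_of_dominated_convergence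
    (bound := fun k : ℕ => (2 / |γ| + 16 / γ ^ 2) * (1 / 2) ^ (k + 1 + 1)) ?_ hl ?_⟩
  · exact Summable.mul_left _ ((summable_nat_add_iff 2).mpr
      (summable_geometric_of_lt_one (by norm_num) (by norm_num)))
  · refine Eventually.of_forall fun j k => ?_
    rw [norm_eq_abs, abs_of_nonneg (gaussApprox_nonneg (hpos j) (by omega) γ)]
    exact gaussApprox_le_of_ne_zero (hpos j) (by omega) hγ

/-- The first K terms tend to 1 each, so the series eventually exceeds any b < K. -/
lemma tendsto_tsum_gaussApprox_zero {N : ℕ → ℕ} (hpos : ∀ j, 0 < N j)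
    (hN : Tendsto N atTop atTop) :
    Tendsto (fun j => ∑' k : ℕ, gaussApprox (N j) (k + 1) 0) atTop atTop := by
  refine tendsto_atTop.mpr fun b => ?_
  obtain ⟨K, hK⟩ := exists_nat_gt b
  have h : Tendsto (fun j => ∑ k ∈ Finset.range K, gaussApprox (N j) (k + 1) 0) atTop
      (𝓝 (∑ _k ∈ Finset.range K, (1 : ℝ))) :=
    tendsto_finsetSum _ fun k _ => tendsto_gaussApprox_zero (by omega) hN
  have hb : b < ∑ _k ∈ Finset.range K, (1 : ℝ) := by simpa using hK
  filter_upwards [h.eventually_const_lt hb] with j hj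
  exact hj.le.trans ((summable_gaussApprox (hpos j) 0).sum_le_tsum _ fun k _ =>
    gaussApprox_nonneg (hpos j) (by omega) 0)

/-! ### The stopping time and the assembled series -/

lemma feedback_eq_goOn_iff (H : Finset (Fin n)) (a : ℝ) (x : Fin n → ℝ) (k : ℕ) :
    feedback H a x k = Signal.goOn
      ↔ lowerThr H a k < partialSum H x k ∧ partialSum H x k < upperThr H a k := by
  unfold feedback
  split_ifs with h1 h2
  · simp [h1]
  · simp [h2]
  · simp [not_le.mp h1, not_le.mp h2]

/-- All rounds before the stop are "continue" rounds, and later visits to the band only enlarge the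
right side. If the procedure never stops, the right side is infinite. -/
lemma stopTime_le (H : Finset (Fin n)) (a : ℝ) (x : Fin n → ℝ) :
    ((stopTime H a x : ℕ∞) : ℝ≥0∞) ≤ 1 + ∑' k : ℕ,
      {x | lowerThr H a (k + 1) < partialSum H x (k + 1)
        ∧ partialSum H x (k + 1) < upperThr H a (k + 1)}.indicator (fun _ => 1) x := by
  classical
  set f : ℕ → ℝ≥0∞ := fun k => {x | lowerThr H a (k + 1) < partialSum H x (k + 1)
        ∧ partialSum H x (k + 1) < upperThr H a (k + 1)}.indicator (fun _ => 1) x with hf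
  have hf1 : ∀ k, feedback H a x (k + 1) = Signal.goOn → f k = 1 := fun k hk => by
    rw [feedback_eq_goOn_iff] at hk
    simp [hf, hk]
  by_cases h : ∃ k, feedback H a x (k + 1) ≠ Signal.goOn
  · have hle : stopTime H a x ≤ ((Nat.find h + 1 : ℕ) : ℕ∞) :=
      sInf_le ⟨Nat.find h + 1, by omega, Nat.find_spec h, rfl⟩
    have hsum : ∑ k ∈ Finset.range (Nat.find h), f k = Nat.find h := by
      rw [Finset.sum_congr rfl fun k hk =>
        hf1 k (not_not.mp (Nat.find_min h (Finset.mem_range.mp hk)))]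
      simp
    calc ((stopTime H a x : ℕ∞) : ℝ≥0∞) ≤ (((Nat.find h + 1 : ℕ) : ℕ∞) : ℝ≥0∞) := by
          exact_mod_cast hle
      _ = 1 + ∑ k ∈ Finset.range (Nat.find h), f k := by
          rw [hsum]
          push_cast
          ring
      _ ≤ 1 + ∑' k, f k := by
          gcongr
          exact ENNReal.sum_le_tsum _
  · push Not at h
    have : ∑' k, f k = ⊤ := by
      rw [tsum_congr fun k => hf1 k (h k)]
      exact ENNReal.tsum_const_eq_top_of_ne_zero one_ne_zero
    rw [this]
    simp

lemma meanStopTime_le (H : Finset (Fin n)) (a : ℝ) :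
    meanStopTime H a ≤ 1 + ∑' k : ℕ, bandProb H a (k + 1) := by
  have hm : ∀ k : ℕ, MeasurableSet {x | lowerThr H a (k + 1) < partialSum H x (k + 1)
        ∧ partialSum H x (k + 1) < upperThr H a (k + 1)} := fun k =>
    measurableSet_band H a (by omega)
  refine (lintegral_mono fun x => stopTime_le H a x).trans (le_of_eq ?_)
  rw [lintegral_add_left measurable_const, lintegral_tsum fun k =>
    (measurable_const.indicator (hm k)).aemeasurable]
  congr 1
  · simp
  · refine tsum_congr fun k => ?_
    rw [lintegral_indicator_const (hm k), one_mul, bandProb]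

lemma tsum_bandProb (hn : 1 ≤ n) (H : Finset (Fin n)) (a : ℝ) :
    ∑' k : ℕ, bandProb H a (k + 1) = ENNReal.ofReal (∑' k : ℕ, (bandProb H a (k + 1)).toReal) := by
  rw [ENNReal.ofReal_tsum_of_nonneg (fun _ => ENNReal.toReal_nonneg) (summable_bandProb hn H a)]
  exact tsum_congr fun k => (ENNReal.ofReal_toReal (measure_ne_top _ _)).symm

lemma summable_cltError (hn : 1 ≤ n) (H : Finset (Fin n)) (α β : ℝ) :
    Summable fun k : ℕ => cltError H α β (k + 1) :=
  (summable_bandProb hn H _).sub (summable_gaussApprox hn _)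

lemma tsum_toReal_bandProb (hn : 1 ≤ n) (H : Finset (Fin n)) (α β : ℝ) :
    ∑' k : ℕ, (bandProb H (α * n) (k + 1)).toReal
      = ∑' k : ℕ, gaussApprox n (k + 1) (α + (1 / 2 - β)) + ∑' k : ℕ, cltError H α β (k + 1) := by
  rw [← (summable_gaussApprox hn _).tsum_add (summable_cltError hn H α β)]
  exact tsum_congr fun k => by rw [cltError]; ring

/-- The total error of the Gaussian approximation is `O(n^{-1/2})`. -/
lemma exists_tsum_abs_cltError_le :
    ∃ C : ℝ, 0 < C ∧ ∀ (n : ℕ) (H : Finset (Fin n)) (α β : ℝ), 2 ≤ n →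
      (H.card : ℝ) = β * n → ∑' k : ℕ, |cltError H α β (k + 1)| ≤ C / √n := by
  obtain ⟨C, hC, h⟩ := exists_abs_cltError_le
  refine ⟨C, hC, fun n H α β hn hβ => ?_⟩
  have hs : HasSum (fun k : ℕ => C / √(n : ℝ) * (1 / 2 : ℝ) ^ (k + 1)) (C / √n) := by
    have h2 := hasSum_geometric_two.mul_left (C / √(n : ℝ) * (1 / 2))
    rw [show C / √(n : ℝ) * (1 / 2) * 2 = C / √n by ring] at h2
    have e : (fun k : ℕ => C / √(n : ℝ) * (1 / 2 : ℝ) ^ (k + 1))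
        = fun k => C / √n * (1 / 2) * (1 / 2) ^ k := by
      ext k
      rw [pow_succ]
      ring
    rwa [e]
  rw [← hs.tsum_eq]
  exact (summable_cltError (by omega) H α β).abs.tsum_le_tsum
    (fun k => h n (k + 1) H α β hn (by omega) hβ) hs.summable

end BitExchange

open BitExchange

theorem mainTheorem2 (α β : ℝ) (N : ℕ → ℕ) (hpos : ∀ j, 0 < N j)
    (hN : Tendsto N atTop atTop)
    (H : ∀ j, Finset (Fin (N j))) (hβ : ∀ j, ((H j).card : ℝ) = β * (N j : ℝ)) :
    (∀ j, Summable fun k : ℕ => BitExchange.cltError (H j) α β (k + 1)) ∧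
    Tendsto (fun j => ∑' k : ℕ, BitExchange.cltError (H j) α β (k + 1)) atTop (𝓝 0) ∧
    (∃ δ : ℕ → ℝ, Tendsto δ atTop (𝓝 0) ∧
      ∀ᶠ j in atTop, ∑' k : ℕ, |BitExchange.cltError (H j) α β (k + 1)|
        ≤ (1 + δ j) * (Real.log (N j) / √(N j : ℝ))) ∧
    (∀ j, Summable fun k : ℕ => BitExchange.gaussApprox (N j) (k + 1) (α + (1 / 2 - β))) ∧
    (∀ j, BitExchange.meanStopTime (H j) (α * (N j : ℝ)) ≤ ENNReal.ofReal
      (1 + ∑' k : ℕ, BitExchange.gaussApprox (N j) (k + 1) (α + (1 / 2 - β))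
        + ∑' k : ℕ, BitExchange.cltError (H j) α β (k + 1))) ∧
    (∃ S : ℝ≥0∞,
      Tendsto (fun j => ENNReal.ofReal
        (∑' k : ℕ, BitExchange.gaussApprox (N j) (k + 1) (α + (1 / 2 - β)))) atTop (𝓝 S) ∧
      Tendsto (fun j => 1 + ∑' k : ℕ, BitExchange.bandProb (H j) (α * (N j : ℝ)) (k + 1))
        atTop (𝓝 (1 + S)) ∧
      limsup (fun j => BitExchange.meanStopTime (H j) (α * (N j : ℝ))) atTop ≤ 1 + S) := by
  obtain ⟨C, hC, hbound⟩ := exists_tsum_abs_cltError_le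
  have hsumE : ∀ j, Summable fun k : ℕ => cltError (H j) α β (k + 1) := fun j =>
    summable_cltError (hpos j) (H j) α β
  have hbd : ∀ᶠ j in atTop, ∑' k : ℕ, |cltError (H j) α β (k + 1)| ≤ C / √(N j : ℝ) := by
    filter_upwards [hN.eventually_ge_atTop 2] with j hj
    exact hbound (N j) (H j) α β hj (hβ j)
  have hE : Tendsto (fun j => ∑' k : ℕ, cltError (H j) α β (k + 1)) atTop (𝓝 0) := by
    refine squeeze_zero_norm' ?_
      ((tendsto_const_nhds (x := C)).div_atTop (tendsto_sqrt_natCast hN))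
    filter_upwards [hbd] with j hj
    exact (norm_tsum_le_tsum_norm (hsumE j).norm).trans hj
  have hband : ∀ j, 1 + ∑' k : ℕ, bandProb (H j) (α * (N j : ℝ)) (k + 1) = ENNReal.ofReal
      (1 + ∑' k : ℕ, gaussApprox (N j) (k + 1) (α + (1 / 2 - β))
        + ∑' k : ℕ, cltError (H j) α β (k + 1)) := by
    intro j
    have h0 : 0 ≤ ∑' k : ℕ, (bandProb (H j) (α * (N j : ℝ)) (k + 1)).toReal :=
      tsum_nonneg fun _ => ENNReal.toReal_nonneg
    rw [tsum_bandProb (hpos j), add_assoc, ← tsum_toReal_bandProb (hpos j),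
      ENNReal.ofReal_add zero_le_one h0, ENNReal.ofReal_one]
  have hT : ∀ j, meanStopTime (H j) (α * (N j : ℝ))
      ≤ 1 + ∑' k : ℕ, bandProb (H j) (α * (N j : ℝ)) (k + 1) := fun j => meanStopTime_le _ _
  have hlim : ∃ S : ℝ≥0∞,
      Tendsto (fun j => ENNReal.ofReal
        (∑' k : ℕ, gaussApprox (N j) (k + 1) (α + (1 / 2 - β)))) atTop (𝓝 S) ∧
      Tendsto (fun j => 1 + ∑' k : ℕ, bandProb (H j) (α * (N j : ℝ)) (k + 1))
        atTop (𝓝 (1 + S)) := by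
    simp_rw [hband]
    -- At γ = 0 the limit is S = ∞, and the vanishing total error cannot affect it; otherwise S is
    -- finite.
    by_cases hγ : α + (1 / 2 - β) = 0
    · rw [hγ]
      have h := tendsto_tsum_gaussApprox_zero hpos hN
      refine ⟨⊤, ENNReal.tendsto_ofReal_atTop.comp h, ?_⟩
      rw [add_top]
      exact ENNReal.tendsto_ofReal_atTop.comp
        ((tendsto_const_nhds.add_atTop h).atTop_add hE)
    · obtain ⟨s, hs⟩ := exists_tendsto_tsum_gaussApprox hpos hN hγ
      have hs0 : 0 ≤ s := ge_of_tendsto' hs fun j => tsum_nonneg fun k =>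
        gaussApprox_nonneg (hpos j) (by omega) _
      refine ⟨ENNReal.ofReal s, ENNReal.tendsto_ofReal hs, ?_⟩
      have h := ENNReal.tendsto_ofReal ((hs.const_add 1).add hE)
      rwa [add_zero, ENNReal.ofReal_add zero_le_one hs0, ENNReal.ofReal_one] at h
  -- The o(1) term can be taken to be 0, because C ≤ log n eventually.
  refine ⟨hsumE, hE, ⟨0, tendsto_const_nhds, ?_⟩, fun j => summable_gaussApprox (hpos j) _,
    fun j => (hT j).trans (hband j).le, ?_⟩
  · have hlog : Tendsto (fun j => Real.log (N j : ℝ)) atTop atTop :=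
      Real.tendsto_log_atTop.comp (tendsto_natCast_atTop_atTop.comp hN)
    filter_upwards [hbd, hlog.eventually_ge_atTop C] with j hj hCj
    refine hj.trans ?_
    rw [Pi.zero_apply, add_zero, one_mul]
    gcongr
  · obtain ⟨S, hS1, hS2⟩ := hlim
    exact ⟨S, hS1, hS2, (limsup_le_limsup (Eventually.of_forall hT)).trans hS2.limsup_eq.le⟩
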